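/- Let $q\in\mathbb C$ with $0<|q|<1$. For $u\in\mathbb C$ and $n\in\mathbb N_0$ put $(u;q)_n=\prod_{j=0}^{n-1}(1-uq^j)$, $(u;q)_\infty=\prod_{j\ge 0}(1-uq^j)$, $(u_1,\dots,u_r;q)_n=\prod_i (u_i;q)_n$ (also for $n=\infty$), and write $z^{\pm}$ for the pair $z,z^{-1}$. Let $${}_4\phi_3\!\left(\begin{matrix}u_1,u_2,u_3,u_4\\ v_1,v_2,v_3\end{matrix};q,q\right)=\sum_{k\ge 0}\frac{(u_1,u_2,u_3,u_4;q)_k}{(q,v_1,v_2,v_3;q)_k}\,q^k ,$$ where, if $u_1=q^{-n}$ with $n\in\mathbb N_0$, the sum runs over $0\le k\le n$. For $x=\frac12(z+z^{-1})$ let $$p_n(x;a,b,c,d|q)=a^{-n}(ab,ac,ad;q)_n\;{}_4\phi_3\!\left(\begin{matrix}q^{-n},q^{n-1}abcd,az,az^{-1}\\ ab,ac,ad\end{matrix};q,q\right)$$ be the Askey--Wilson polynomial; when $ab$, $ac$ or $ad$ makes a denominator vanish, $p_n$ is defined by multiplying $(ab,ac,ad;q)_n$ into the terminating sum. **Theorem.**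 Let $n\in\mathbb N_0$, let $z,a,b,c,d,e,f\in\mathbb C\setminus\{0\}$ with $\max\{|cz|,|c/z|\}<1$, and let $x=\frac12(z+z^{-1})$. Assume that none of $ac$, $bc$, $cf$, $ae$, $be$, $ef$, $abcf$, $abef/q$, $ez$, $e/z$ lies in $\{q^{-j}:j\in\mathbb N_0\}$. (i) If $(cd;q)_n\ne 0$ and $(q^{1-k}c/e;q)_n\neq 0$ for all $k\in\mathbb N_0$, then $$p_{n}(x;a,b,c,d|q)=\frac{(ae,be,ef,abcf,cz^\pm;q)_\infty}{(ac,bc,cf,abef,ez^\pm;q)_\infty}(ac,bc,cd;q)_{n}\sum_{k=0}^\infty c^{k-n}\frac{(abef;q)_{2k}(\frac{e}{c},\frac{abef}{q};q)_k}{(\frac{abef}{q};q)_{2k}(q,ae,be,ef,abcf;q)_k}\,p_k(x;a,b,e,f|q)\;{}_4\phi_3\!\left(\begin{matrix}q^{-n},q^{n-1}abcd,cf,\frac{qc}{e}\\ cd,q^kabcf,q^{1-k}\frac{c}{e}\end{matrix};q,q\right).$$ (ii) If neither $ab$ nor $q^{1-n}f/d$ lies in $\{q^{-j}:j\in\mathbb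 N_0\}$, then $$p_{n}(x;a,b,c,d|q)=\frac{(ae,be,ef,abcf,cz^\pm;q)_\infty}{(ac,bc,cf,abef,ez^\pm;q)_\infty}\,\frac{(ab,ac,bc,\frac{d}{f};q)_{n}}{(abcf;q)_n}\sum_{k=0}^\infty f^{n-k}\frac{(abef;q)_{2k}(\frac{abef}{q};q)_k}{(\frac{abef}{q};q)_{2k}(q,ab,ae,be;q)_k}\,p_k(x;a,b,e,f|q)\;{}_4\phi_3\!\left(\begin{matrix}q^{-k},q^{k-1}abef,cf,\frac{qf}{d}\\ ef,q^nabcf,q^{1-n}\frac{f}{d}\end{matrix};q,q\right).$$ Both infinite series converge absolutely. -/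

import Mathlib

open Finset

/-- The finite `q`-shifted factorial `(a;q)_n = (1 - a)(1 - aq) ⋯ (1 - aq^{n-1})`. -/
def qPoch (a q : ℂ) (n : ℕ) : ℂ := ∏ j ∈ range n, (1 - a * q ^ j)

/-- The infinite `q`-shifted factorial `(a;q)_∞ = ∏_{j ≥ 0} (1 - aq^j)`, for `|q| < 1`. -/
noncomputable def qPochInf (a q : ℂ) : ℂ := ∏' j : ℕ, (1 - a * q ^ j)

/-- The product `(a₁, …, a_r; q)_n = (a₁;q)_n ⋯ (a_r;q)_n`. -/
def qPochs (as : List ℂ) (q : ℂ) (n : ℕ) : ℂ := (as.map fun a => qPoch a q n).prod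

/-- The product `(a₁, …, a_r; q)_∞ = (a₁;q)_∞ ⋯ (a_r;q)_∞`. -/
noncomputable def qPochsInf (as : List ℂ) (q : ℂ) : ℂ := (as.map fun a => qPochInf a q).prod

/-- The basic hypergeometric series `_rφ_s(a₁, …, a_r; b₁, …, b_s; q, w)`. If some `aᵢ` equals
`q^{-n}`, the terms with index `k > n` vanish and the series is a finite sum. -/
noncomputable def basicHyp (as bs : List ℂ) (q w : ℂ) : ℂ :=
  ∑' k : ℕ, qPochs as q k / qPochs (q :: bs) q k
    * ((-1) ^ k * q ^ (k.choose 2)) ^ (1 + (bs.length : ℤ) - (as.length : ℤ)) * w ^ k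

/-- The Askey--Wilson polynomial `p_n(x; a, b, c, d | q)`, for `a ≠ 0`. It is
`a^{-n} (ab, ac, ad; q)_n` times the terminating series
`_4φ_3(q^{-n}, q^{n-1}abcd, az, a/z; ab, ac, ad; q, q)`, where `x = (z + 1/z)/2`
(see `askeyWilson_eq`), with the factor `(ab, ac, ad; q)_n` multiplied into the sum, so that no
condition on `ab, ac, ad` is needed, and with `(az, a/z; q)_k` written as the polynomial
`∏_{j < k} (1 - 2axq^j + a²q^{2j})` in `x`. -/
noncomputable def askeyWilson (n : ℕ) (x a b c d q : ℂ) : ℂ :=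
  (a ^ n)⁻¹ * ∑ k ∈ range (n + 1),
    qPochs [q ^ (-(n : ℤ)), q ^ ((n : ℤ) - 1) * (a * b * c * d)] q k / qPoch q q k
      * (∏ j ∈ range k, (1 - 2 * a * x * q ^ j + a ^ 2 * q ^ (2 * j)))
      * qPochs [a * b * q ^ k, a * c * q ^ k, a * d * q ^ k] q (n - k)
      * q ^ k

theorem qPoch_split (a q : ℂ) {k n : ℕ} (h : k ≤ n) :
    qPoch a q n = qPoch a q k * qPoch (a * q ^ k) q (n - k) := by
  obtain ⟨m, rfl⟩ := Nat.exists_eq_add_of_le h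
  simp only [qPoch, prod_range_add, Nat.add_sub_cancel_left]
  congr 1
  refine prod_congr rfl fun j _ => ?_
  ring

theorem qPoch_ne_zero {a q : ℂ} {k n : ℕ} (h : ∀ j < n, a * q ^ j ≠ 1) (hk : k ≤ n) :
    qPoch a q k ≠ 0 := by
  refine prod_ne_zero_iff.2 fun j hj => sub_ne_zero.2 (h j ?_).symm
  exact (mem_range.1 hj).trans_le hk

theorem qPoch_neg_pow_eq_zero {q : ℂ} (hq : q ≠ 0) {n k : ℕ} (h : n < k) :
    qPoch (q ^ (-(n : ℤ))) q k = 0 := by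
  refine prod_eq_zero (mem_range.2 h) ?_
  rw [← zpow_natCast q n, ← zpow_add₀ hq]
  simp

/-- The partial products of `(a;q)_∞` converge to it. -/
theorem tendsto_qPoch_qPochInf (a : ℂ) {q : ℂ} (hq : ‖q‖ < 1) :
    Filter.Tendsto (fun n => qPoch a q n) Filter.atTop (nhds (qPochInf a q)) := by
  have hs : Summable fun j : ℕ => ‖-(a * q ^ j)‖ := by
    simpa [norm_mul, norm_pow] using
      (summable_geometric_of_lt_one (norm_nonneg q) hq).mul_left ‖a‖
  have := (multipliable_one_add_of_summable hs).tendsto_prod_tprod_nat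
  simpa only [← sub_eq_add_neg, qPoch, qPochInf] using this

/-- The hypergeometric formula for the Askey--Wilson polynomials. -/
theorem askeyWilson_eq (n : ℕ) {z a b c d q : ℂ} (hq : q ≠ 0) (hz : z ≠ 0)
    (hab : ∀ j < n, a * b * q ^ j ≠ 1) (hac : ∀ j < n, a * c * q ^ j ≠ 1)
    (had : ∀ j < n, a * d * q ^ j ≠ 1) :
    askeyWilson n ((z + z⁻¹) / 2) a b c d q =
      (a ^ n)⁻¹ * qPochs [a * b, a * c, a * d] q n *
        basicHyp [q ^ (-(n : ℤ)), q ^ ((n : ℤ) - 1) * (a * b * c * d), a * z, a / z]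
          [a * b, a * c, a * d] q q := by
  have hfin : ∀ k ∉ range (n + 1),
      qPochs [q ^ (-(n : ℤ)), q ^ ((n : ℤ) - 1) * (a * b * c * d), a * z, a / z] q k
        / qPochs [q, a * b, a * c, a * d] q k
        * ((-1) ^ k * q ^ (k.choose 2)) ^ (1 + (([a * b, a * c, a * d] : List ℂ).length : ℤ)
          - (([q ^ (-(n : ℤ)), q ^ ((n : ℤ) - 1) * (a * b * c * d), a * z, a / z] :
            List ℂ).length : ℤ)) * q ^ k = 0 := by
    intro k hk
    have : n < k := by simpa [Nat.lt_succ_iff] using hk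
    simp only [qPochs, List.map_cons, List.prod_cons, qPoch_neg_pow_eq_zero hq this, zero_mul,
      zero_div]
  rw [askeyWilson, basicHyp, tsum_eq_sum hfin, mul_assoc (a ^ n)⁻¹]
  congr 1
  rw [mul_sum]
  refine sum_congr rfl fun k hk => ?_
  have hk' : k ≤ n := Nat.lt_succ_iff.1 (mem_range.1 hk)
  have hzz : ∏ j ∈ range k, (1 - 2 * a * ((z + z⁻¹) / 2) * q ^ j + a ^ 2 * q ^ (2 * j))
      = qPoch (a * z) q k * qPoch (a / z) q k := by
    rw [qPoch, qPoch, ← prod_mul_distrib]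
    refine prod_congr rfl fun j _ => ?_
    field_simp
    ring
  have h1 := qPoch_ne_zero hab hk'
  have h2 := qPoch_ne_zero hac hk'
  have h3 := qPoch_ne_zero had hk'
  rw [hzz]
  simp only [qPochs, List.map_cons, List.map_nil, List.prod_cons, List.prod_nil, mul_one,
    List.length_cons, List.length_nil]
  rw [qPoch_split (a * b) q hk', qPoch_split (a * c) q hk', qPoch_split (a * d) q hk']
  norm_num
  by_cases h4 : qPoch q q k = 0
  · simp [h4]
  · field_simp

/-!
Expand `p_n(x; a, b, c, d | q)` in the basis `(cz, c/z; q)_j`. After division by the infinite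
products, and up to factors free of `z`, `(cz, c/z; q)_j` becomes a function of the single point
`w = c qʲ`, so it suffices to expand that function in the polynomials `p_k(x; a, b, e, f | q)`. At
the nodes `w = e qᵐ` the expansion is finite, and it holds there because Bailey's matrix inversion
inverts the defining sum of `p_k(x; e, a, b, f | q)`. Both sides are holomorphic in the disc
`max(|wz|, |w/z|) < 1`, where the nodes accumulate at the origin, so the expansion holds throughout
the disc.

Summing over `j` leaves a terminating sum as the coefficient of `p_k`. It is a balanced `₄φ₃` as it
stands, which gives (i); re-expanding `(e/c; q)_k` by the `q`-Saalschütz sum and interchanging the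
two summations gives (ii). The symmetry of `p_n` in `a, b, c, d` is also a consequence of the
`q`-Saalschütz sum: it turns `p_n` into a convolution that is visibly symmetric in `a, b`.
-/

/-- The parameter `u` is not of the form `q ^ (-j)` with `j : ℕ`, that is, none of the factorials
`(u;q)_n` vanishes. For `u = q` this says that `q` is not a root of unity. -/
def QRegular (u q : ℂ) : Prop := ∀ j : ℕ, u * q ^ j ≠ 1

variable {q : ℂ}

namespace QRegular

variable {u : ℂ}

theorem mul_pow (h : QRegular u q) (i : ℕ) : QRegular (u * q ^ i) q := fun j => by
  rw [mul_assoc, ← pow_add]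
  exact h (i + j)

theorem one_sub_mul_pow_ne_zero (h : QRegular u q) (i : ℕ) : 1 - u * q ^ i ≠ 0 :=
  sub_ne_zero.2 (h i).symm

theorem qPoch_ne_zero (h : QRegular u q) (n : ℕ) : qPoch u q n ≠ 0 :=
  _root_.qPoch_ne_zero (fun j _ => h j) le_rfl

theorem of_norm_lt_one (hq1 : ‖q‖ < 1) (hu : ‖u‖ < 1) : QRegular u q := fun j h => by
  have hlt : ‖u‖ * ‖q‖ ^ j < 1 :=
    mul_lt_one_of_nonneg_of_lt_one_left (norm_nonneg u) hu (pow_le_one₀ (norm_nonneg q) hq1.le)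
  rw [← norm_pow, ← norm_mul, h, norm_one] at hlt
  exact hlt.false

end QRegular

theorem qPoch_zero (a q : ℂ) : qPoch a q 0 = 1 := prod_range_zero _

theorem qPoch_succ (a q : ℂ) (n : ℕ) : qPoch a q (n + 1) = qPoch a q n * (1 - a * q ^ n) :=
  prod_range_succ _ n

theorem qPoch_add (a q : ℂ) (m n : ℕ) :
    qPoch a q (m + n) = qPoch a q m * qPoch (a * q ^ m) q n := by
  simpa using qPoch_split a q (Nat.le_add_right m n)

theorem qPoch_succ' (a q : ℂ) (n : ℕ) : qPoch a q (n + 1) = (1 - a) * qPoch (a * q) q n := by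
  rw [add_comm, qPoch_add]
  simp [qPoch]

theorem qPoch_reflect (hq0 : q ≠ 0) {w : ℂ} (hw : w ≠ 0) (m : ℕ) :
    qPoch w q m = (-w) ^ m * q ^ m.choose 2 * qPoch (q ^ (1 - (m : ℤ)) / w) q m := by
  induction m with
  | zero => simp [qPoch]
  | succ m ih =>
    have hbase : q ^ (1 - ((m + 1 : ℕ) : ℤ)) / w * q = q ^ (1 - (m : ℤ)) / w := by
      rw [div_mul_eq_mul_div, ← zpow_add_one₀ hq0]
      congr 2
      push_cast
      ring
    have hpow : q ^ (1 - ((m + 1 : ℕ) : ℤ)) * q ^ m = 1 := by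
      rw [← zpow_natCast q m, ← zpow_add₀ hq0]
      simp
    rw [qPoch_succ, ih, qPoch_succ', hbase, Nat.choose_succ_succ', Nat.choose_one_right, pow_add]
    field_simp
    linear_combination (-((-w) ^ m * q ^ m.choose 2 * qPoch (q ^ (1 - (m : ℤ)) / w) q m)) * hpow

theorem qPoch_mul_pow_reflect (hq0 : q ≠ 0) {w : ℂ} (hw : w ≠ 0) (i l : ℕ) :
    qPoch (w * q ^ i) q l = (-w) ^ l * q ^ (i * l + l.choose 2)
      * qPoch (q ^ (1 - ((i + l : ℕ) : ℤ)) / w) q l := by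
  have hbase : q ^ (1 - (l : ℤ)) / (w * q ^ i) = q ^ (1 - ((i + l : ℕ) : ℤ)) / w := by
    rw [show 1 - (l : ℤ) = 1 - ((i + l : ℕ) : ℤ) + i by push_cast; ring, zpow_add₀ hq0,
      zpow_natCast]
    field_simp
  rw [qPoch_reflect hq0 (mul_ne_zero hw (pow_ne_zero i hq0)), hbase, ← neg_mul, mul_pow]
  ring

theorem zpow_neg_add_mul_pow (hq0 : q ≠ 0) (j l : ℕ) :
    q ^ (-((j + l : ℕ) : ℤ)) * q ^ j = q ^ (-(l : ℤ)) := by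
  rw [← zpow_natCast q j, ← zpow_add₀ hq0]
  congr 1
  push_cast
  ring

theorem qPoch_self_add (hq0 : q ≠ 0) (i l : ℕ) :
    qPoch q q (i + l) = (-1) ^ i * q ^ ((l + 1) * i + i.choose 2)
      * qPoch (q ^ (-((i + l : ℕ) : ℤ))) q i * qPoch q q l := by
  have hbase : q ^ (1 - (i : ℤ)) / (q * q ^ l) = q ^ (-((i + l : ℕ) : ℤ)) := by
    rw [← pow_succ', ← zpow_natCast q, ← zpow_sub₀ hq0]
    congr 1
    push_cast
    ring
  rw [add_comm i l, qPoch_add, qPoch_reflect hq0 (mul_ne_zero hq0 (pow_ne_zero l hq0)), hbase,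
    neg_pow, add_comm l i]
  ring

/-- The summand of the `q`-Saalschütz sum `_3φ_2(q⁻ⁱ⁻ˡ, u, v; ⋯; q, q)`, with all parameters
brought into the numerator; `i + l` is constant along the sum. -/
noncomputable def saalschutzTerm (u v G q : ℂ) (i l : ℕ) : ℂ :=
  G ^ i * qPoch u q i * qPoch v q i * qPoch G q l * qPoch (u * v * G * q ^ i) q l
    / (qPoch q q i * qPoch q q l)

/-- The telescoping certificate (in the sense of Wilf and Zeilberger) for `saalschutzTerm`. -/
noncomputable def saalschutzCert (u v G q : ℂ) (i l : ℕ) : ℂ :=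
  -(q ^ l * (1 - q ^ i) * (G ^ i * qPoch u q i * qPoch v q i * qPoch G q l
    * qPoch (u * v * G / q * q ^ i) q l) / (qPoch q q i * qPoch q q l))

theorem saalschutzTerm_telescope (hq0 : q ≠ 0) (hq : QRegular q q) (u v G : ℂ) (i l : ℕ) :
    (1 - q ^ (i + l + 1)) * saalschutzTerm u v G q i (l + 1)
      - (1 - u * G * q ^ (i + l)) * (1 - v * G * q ^ (i + l)) * saalschutzTerm u v G q i l
      = saalschutzCert u v G q (i + 1) l - saalschutzCert u v G q i (l + 1) := by
  have hi := hq.qPoch_ne_zero i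
  have hl := hq.qPoch_ne_zero l
  have hi' := hq.one_sub_mul_pow_ne_zero i
  have hl' := hq.one_sub_mul_pow_ne_zero l
  have hshift : u * v * G / q * q ^ (i + 1) = u * v * G * q ^ i := by
    field_simp
    ring
  have hsucc : qPoch (u * v * G / q * q ^ i) q (l + 1)
      = (1 - u * v * G / q * q ^ i) * qPoch (u * v * G * q ^ i) q l := by
    rw [qPoch_succ', mul_assoc _ (q ^ i), ← pow_succ, hshift]
  simp only [saalschutzTerm, saalschutzCert, hshift, hsucc]
  simp only [qPoch_succ, pow_succ, pow_add]
  generalize qPoch (u * v * G * q ^ i) q l = A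
  generalize qPoch q q i = B at *
  generalize qPoch q q l = C at *
  generalize q ^ i = x at *
  generalize q ^ l = y at *
  have hx : 1 - x * q ≠ 0 := by rwa [mul_comm]
  have hy : 1 - y * q ≠ 0 := by rwa [mul_comm]
  field_simp
  ring

theorem sum_saalschutzTerm_succ (hq0 : q ≠ 0) (hq : QRegular q q) (u v G : ℂ) (k : ℕ) :
    (1 - q ^ (k + 1)) * ∑ p ∈ antidiagonal (k + 1), saalschutzTerm u v G q p.1 p.2
      = (1 - u * G * q ^ k) * (1 - v * G * q ^ k)
        * ∑ p ∈ antidiagonal k, saalschutzTerm u v G q p.1 p.2 := by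
  have htel : ∑ p ∈ antidiagonal k, ((1 - q ^ (k + 1)) * saalschutzTerm u v G q p.1 (p.2 + 1)
        - (1 - u * G * q ^ k) * (1 - v * G * q ^ k) * saalschutzTerm u v G q p.1 p.2)
      = ∑ p ∈ antidiagonal k,
        (saalschutzCert u v G q (p.1 + 1) p.2 - saalschutzCert u v G q p.1 (p.2 + 1)) := by
    refine sum_congr rfl fun p hp => ?_
    rw [← mem_antidiagonal.1 hp]
    exact saalschutzTerm_telescope hq0 hq u v G p.1 p.2
  have hcert := Nat.sum_antidiagonal_succ (n := k) (f := fun p => saalschutzCert u v G q p.1 p.2)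
  rw [Nat.sum_antidiagonal_succ'] at hcert
  dsimp only at hcert
  have hfirst : saalschutzCert u v G q 0 (k + 1) = 0 := by simp [saalschutzCert]
  have hlast : saalschutzCert u v G q (k + 1) 0
      = -((1 - q ^ (k + 1)) * saalschutzTerm u v G q (k + 1) 0) := by
    simp only [saalschutzCert, saalschutzTerm, qPoch_zero, pow_zero]
    ring
  rw [sum_sub_distrib, sum_sub_distrib, ← mul_sum, ← mul_sum] at htel
  rw [Nat.sum_antidiagonal_succ']
  linear_combination htel - hcert + hlast - hfirst

theorem sum_saalschutzTerm (hq0 : q ≠ 0) (hq : QRegular q q) (u v G : ℂ) (k : ℕ) :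
    ∑ p ∈ antidiagonal k, saalschutzTerm u v G q p.1 p.2
      = qPoch (u * G) q k * qPoch (v * G) q k / qPoch q q k := by
  induction k with
  | zero => simp [saalschutzTerm, qPoch]
  | succ k ih =>
    have hk := hq.qPoch_ne_zero k
    have hk' := hq.one_sub_mul_pow_ne_zero k
    have h := sum_saalschutzTerm_succ hq0 hq u v G k
    rw [pow_succ'] at h
    rw [eq_div_iff hk] at ih
    simp only [qPoch_succ]
    rw [eq_div_iff (mul_ne_zero hk hk')]
    linear_combination qPoch q q k * h + (1 - u * G * q ^ k) * (1 - v * G * q ^ k) * ih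

/-- The factor `(q⁻ⁿ, q^{n-1}s;q)_j qʲ / (q;q)_j` shared by all terminating balanced series
below: the sum over `j` runs up to `n`, and `s` is the product of the four parameters of
the Askey–Wilson polynomial. -/
noncomputable def awWeight (s q : ℂ) (n j : ℕ) : ℂ :=
  qPoch (q ^ (-(n : ℤ))) q j * qPoch (q ^ ((n : ℤ) - 1) * s) q j / qPoch q q j * q ^ j

theorem pow_choose_two_balance (hq0 : q ≠ 0) (i l : ℕ) :
    q ^ ((l + 1) * i + i.choose 2) * q ^ (i + l).choose 2 * (q ^ (1 - ((i + l : ℕ) : ℤ))) ^ i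
      = q ^ i * q ^ (i * l + l.choose 2) := by
  have hexp : (l + 1) * i + i.choose 2 + (i + l).choose 2
      = i * (i + l) + (i * l + l.choose 2) := by
    qify
    push_cast [Nat.cast_choose_two]
    ring
  have hcancel : q ^ (i * (i + l)) * (q ^ (1 - ((i + l : ℕ) : ℤ))) ^ i = q ^ i := by
    rw [mul_comm i, pow_mul, ← mul_pow, ← zpow_natCast q (i + l), ← zpow_add₀ hq0]
    simp
  rw [← pow_add, hexp, pow_add, ← hcancel]
  ring

theorem awWeight_mul_eq_saalschutzTerm (hq0 : q ≠ 0) (hq : QRegular q q) {E : ℂ} (hE : E ≠ 0)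
    (s X : ℂ) (i l : ℕ) :
    awWeight s q (i + l) i * (qPoch X q i * qPoch (E * q ^ i) q l * qPoch (X * s / E * q ^ i) q l)
      = (-E) ^ (i + l) * q ^ (i + l).choose 2 * qPoch q q (i + l)
        * saalschutzTerm X (q ^ (((i + l : ℕ) : ℤ) - 1) * s) (q ^ (1 - ((i + l : ℕ) : ℤ)) / E)
          q i l := by
  have hi := hq.qPoch_ne_zero i
  have hl := hq.qPoch_ne_zero l
  have hF : X * (q ^ (((i + l : ℕ) : ℤ) - 1) * s) * (q ^ (1 - ((i + l : ℕ) : ℤ)) / E)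
      = X * s / E := by
    rw [← neg_sub 1 ((i + l : ℕ) : ℤ), zpow_neg]
    field_simp
  have hsign : (-1 : ℂ) ^ (i + l) * (-1) ^ i = (-1) ^ l := by
    rw [pow_add, mul_right_comm, ← mul_pow]
    simp
  have hpow := pow_choose_two_balance hq0 i l
  rw [awWeight, saalschutzTerm, hF, qPoch_mul_pow_reflect hq0 hE, qPoch_self_add hq0, div_pow,
    neg_pow E l, neg_pow E (i + l), ← hsign]
  field_simp
  generalize qPoch _ q i = U, qPoch (_ * s) q i = V, qPoch X q i = W, qPoch _ q l = G,
    qPoch _ q l = H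
  linear_combination (-(U * V * W * G * H * E ^ (i + l))) * hpow

theorem sum_awWeight_balanced (hq0 : q ≠ 0) (hq : QRegular q q) {s X E F : ℂ} (hX : X ≠ 0)
    (hE : E ≠ 0) (h : X * s = E * F) (N : ℕ) :
    ∑ m ∈ range (N + 1), awWeight s q N m
        * (qPoch X q m * qPoch (E * q ^ m) q (N - m) * qPoch (F * q ^ m) q (N - m))
      = X ^ N * qPoch (E / X) q N * qPoch (F / X) q N := by
  have hN := hq.qPoch_ne_zero N
  have hF : X * s / E = F := by rw [h, mul_div_cancel_left₀ F hE]
  have hXG : q ^ (1 - (N : ℤ)) / (E / X) = X * (q ^ (1 - (N : ℤ)) / E) := by field_simp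
  have hvG : q ^ ((N : ℤ) - 1) * s * (q ^ (1 - (N : ℤ)) / E) = F / X := by
    rw [← hF, ← neg_sub 1 (N : ℤ), zpow_neg]
    field_simp
  rw [← Nat.sum_antidiagonal_eq_sum_range_succ (fun m l => awWeight s q N m
    * (qPoch X q m * qPoch (E * q ^ m) q l * qPoch (F * q ^ m) q l))]
  calc _ = ∑ p ∈ antidiagonal N, (-E) ^ N * q ^ N.choose 2 * qPoch q q N
          * saalschutzTerm X (q ^ ((N : ℤ) - 1) * s) (q ^ (1 - (N : ℤ)) / E) q p.1 p.2 :=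
        sum_congr rfl fun p hp => by
          rw [← mem_antidiagonal.1 hp, ← hF, awWeight_mul_eq_saalschutzTerm hq0 hq hE]
    _ = (-E) ^ N * q ^ N.choose 2 * qPoch (X * (q ^ (1 - (N : ℤ)) / E)) q N
          * qPoch (F / X) q N := by
        rw [← mul_sum, sum_saalschutzTerm hq0 hq, hvG]
        field_simp
    _ = X ^ N * qPoch (E / X) q N * qPoch (F / X) q N := by
        rw [qPoch_reflect hq0 (div_ne_zero hE hX), hXG, ← neg_div, div_pow]
        field_simp

/-! ### Symmetry of the Askey–Wilson polynomials -/

theorem sum_awWeight_balanced_div (hq0 : q ≠ 0) (hq : QRegular q q) {s X E F : ℂ} (hX : X ≠ 0)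
    (hE : E ≠ 0) (hF : QRegular F q) (h : X * s = E * F) (N : ℕ) :
    ∑ m ∈ range (N + 1), awWeight s q N m
        * (qPoch (E * q ^ m) q (N - m) * (qPoch X q m / qPoch F q m))
      = X ^ N * qPoch (E / X) q N * (qPoch (F / X) q N / qPoch F q N) := by
  have hN := hF.qPoch_ne_zero N
  rw [← mul_div_assoc, eq_div_iff hN, ← sum_awWeight_balanced hq0 hq hX hE h N, sum_mul]
  refine sum_congr rfl fun m hm => ?_
  have hm' := hF.qPoch_ne_zero m
  rw [qPoch_split F q (Nat.lt_succ_iff.1 (mem_range.1 hm))]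
  field_simp

theorem askeyWilson_eq_sum_awWeight (n : ℕ) {z : ℂ} (hz : z ≠ 0) (a b c d q : ℂ) :
    askeyWilson n ((z + z⁻¹) / 2) a b c d q = (a ^ n)⁻¹ * ∑ k ∈ range (n + 1),
      awWeight (a * b * c * d) q n k * (qPoch (a * z) q k * qPoch (a / z) q k)
        * (qPoch (a * b * q ^ k) q (n - k) * qPoch (a * c * q ^ k) q (n - k)
          * qPoch (a * d * q ^ k) q (n - k)) := by
  rw [askeyWilson]
  congr 1
  refine sum_congr rfl fun k _ => ?_
  have hquad : ∏ j ∈ range k, (1 - 2 * a * ((z + z⁻¹) / 2) * q ^ j + a ^ 2 * q ^ (2 * j))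
      = qPoch (a * z) q k * qPoch (a / z) q k := by
    rw [qPoch, qPoch, ← prod_mul_distrib]
    refine prod_congr rfl fun j _ => ?_
    field_simp
    ring
  rw [hquad, awWeight]
  simp only [qPochs, List.map_cons, List.map_nil, List.prod_cons, List.prod_nil, mul_one]
  ring

section Convolution

variable {a c d z : ℂ}

theorem awWeight_mul_qPoch_div_eq_sum (hq0 : q ≠ 0) (hq : QRegular q q) (hz : z ≠ 0) (hc : c ≠ 0)
    (hd : d ≠ 0) (a b : ℂ) (n k : ℕ) :
    awWeight (a * b * c * d) q n k * qPoch (a / z) q k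
      = qPoch (q ^ (-(n : ℤ))) q k * q ^ k * ∑ p ∈ antidiagonal k,
        saalschutzTerm (b * z) (q ^ (1 - (n : ℤ)) / (c * d)) (q ^ ((n : ℤ) - 1) * (a * c * d) / z)
          q p.1 p.2 := by
  have hu : b * z * (q ^ ((n : ℤ) - 1) * (a * c * d) / z)
      = q ^ ((n : ℤ) - 1) * (a * b * c * d) := by field_simp
  have hv : q ^ (1 - (n : ℤ)) / (c * d) * (q ^ ((n : ℤ) - 1) * (a * c * d) / z) = a / z := by
    rw [← neg_sub (n : ℤ) 1, zpow_neg]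
    field_simp
  rw [sum_saalschutzTerm hq0 hq, hu, hv, awWeight]
  ring

theorem sum_saalschutzTerm_mul_eq (hq0 : q ≠ 0) (hq : QRegular q q) (hz : z ≠ 0) (ha : a ≠ 0)
    (hc : c ≠ 0) (hd : d ≠ 0) (b : ℂ) (j l : ℕ) :
    ∑ m ∈ range (l + 1), qPoch (q ^ (-((j + l : ℕ) : ℤ))) q (j + m) * q ^ (j + m)
        * saalschutzTerm (b * z) (q ^ (1 - ((j + l : ℕ) : ℤ)) / (c * d))
          (q ^ (((j + l : ℕ) : ℤ) - 1) * (a * c * d) / z) q j m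
        * (qPoch (a * z) q (j + m) * (qPoch (a * b * q ^ (j + m)) q (l - m)
          * qPoch (a * c * q ^ (j + m)) q (l - m) * qPoch (a * d * q ^ (j + m)) q (l - m)))
      = qPoch (q ^ (-((j + l : ℕ) : ℤ))) q j * q ^ j
        * (q ^ (((j + l : ℕ) : ℤ) - 1) * (a * c * d) / z) ^ j
        * qPoch (q ^ (1 - ((j + l : ℕ) : ℤ)) / (c * d)) q j * (a * z * q ^ j) ^ l / qPoch q q j
        * (qPoch (a * z) q j * qPoch (b * z) q j * qPoch (c / z) q l * qPoch (d / z) q l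
          * qPoch (a * b * q ^ j) q l) := by
  have hj := pow_ne_zero j hq0
  have hbal : a * z * q ^ j * (a * c * d * q ^ j / z) = a * c * q ^ j * (a * d * q ^ j) := by
    field_simp
  have hin := sum_awWeight_balanced hq0 hq (mul_ne_zero (mul_ne_zero ha hz) hj)
    (mul_ne_zero (mul_ne_zero ha hc) hj) hbal l
  rw [show a * c * q ^ j / (a * z * q ^ j) = c / z by field_simp,
    show a * d * q ^ j / (a * z * q ^ j) = d / z by field_simp] at hin
  have huvG : b * z * (q ^ (1 - ((j + l : ℕ) : ℤ)) / (c * d))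
      * (q ^ (((j + l : ℕ) : ℤ) - 1) * (a * c * d) / z) = a * b := by
    rw [← neg_sub ((j + l : ℕ) : ℤ) 1, zpow_neg]
    field_simp
  have hG : q ^ (((j + l : ℕ) : ℤ) - 1) * (a * c * d) / z
      = q ^ ((l : ℤ) - 1) * (a * c * d * q ^ j / z) := by
    rw [show ((j + l : ℕ) : ℤ) - 1 = (l : ℤ) - 1 + j by push_cast; ring, zpow_add₀ hq0,
      zpow_natCast]
    ring
  calc _ = ∑ m ∈ range (l + 1), qPoch (q ^ (-((j + l : ℕ) : ℤ))) q j * q ^ j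
        * (q ^ (((j + l : ℕ) : ℤ) - 1) * (a * c * d) / z) ^ j
        * qPoch (q ^ (1 - ((j + l : ℕ) : ℤ)) / (c * d)) q j / qPoch q q j
        * (qPoch (a * z) q j * qPoch (b * z) q j * qPoch (a * b * q ^ j) q l)
        * (awWeight (a * c * d * q ^ j / z) q l m
          * (qPoch (a * z * q ^ j) q m * qPoch (a * c * q ^ j * q ^ m) q (l - m)
            * qPoch (a * d * q ^ j * q ^ m) q (l - m))) := by
        refine sum_congr rfl fun m hm => ?_
        rw [saalschutzTerm, huvG, awWeight, ← hG,
          qPoch_split (a * b * q ^ j) q (Nat.lt_succ_iff.1 (mem_range.1 hm)),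
          qPoch_add (q ^ (-((j + l : ℕ) : ℤ))), zpow_neg_add_mul_pow hq0, qPoch_add (a * z)]
        simp only [pow_add q j m, mul_assoc]
        ring
    _ = _ := by
        rw [← mul_sum, hin]
        ring

theorem convolution_prefactor (hq0 : q ≠ 0) (hc : c ≠ 0) (hd : d ≠ 0) (a z : ℂ) (j l : ℕ) :
    qPoch (q ^ (-((j + l : ℕ) : ℤ))) q j * q ^ j
        * (q ^ (((j + l : ℕ) : ℤ) - 1) * (a * c * d) / z) ^ j
        * qPoch (q ^ (1 - ((j + l : ℕ) : ℤ)) / (c * d)) q j * (a * z * q ^ j) ^ l * qPoch q q l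
      = a ^ (j + l) * (z ^ l * z⁻¹ ^ j) * qPoch (c * d * q ^ l) q j * qPoch q q (j + l) := by
  have hpow : q ^ j * (q ^ (((j + l : ℕ) : ℤ) - 1)) ^ j * (q ^ j) ^ l
      = q ^ (l * j + j.choose 2) * q ^ ((l + 1) * j + j.choose 2) := by
    have hexp : (j + l) * j + j * l = l * j + j.choose 2 + ((l + 1) * j + j.choose 2) := by
      qify
      push_cast [Nat.cast_choose_two]
      ring
    rw [← mul_pow, ← zpow_one_add₀ hq0, add_sub_cancel, zpow_natCast, ← pow_mul, ← pow_mul,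
      ← pow_add, hexp, pow_add]
  have hsign : (-1 : ℂ) ^ j * (-1) ^ j = 1 := by
    rw [← mul_pow]
    simp
  rw [qPoch_mul_pow_reflect hq0 (mul_ne_zero hc hd), qPoch_self_add hq0, add_comm l j, neg_pow,
    pow_add a, inv_pow]
  simp only [mul_pow, div_pow]
  generalize qPoch _ q j = U, qPoch _ q j = V
  linear_combination (a ^ j * c ^ j * d ^ j / z ^ j * a ^ l * z ^ l * U * V * qPoch q q l) * hpow
    - (a ^ j * a ^ l * z ^ l * (z ^ j)⁻¹ * c ^ j * d ^ j * U * V * qPoch q q l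
      * q ^ (l * j + j.choose 2) * q ^ ((l + 1) * j + j.choose 2)) * hsign

theorem askeyWilson_eq_convolution (hq0 : q ≠ 0) (hq : QRegular q q) (n : ℕ) (hz : z ≠ 0)
    (ha : a ≠ 0) (hc : c ≠ 0) (hd : d ≠ 0) (b : ℂ) :
    askeyWilson n ((z + z⁻¹) / 2) a b c d q = qPoch q q n * ∑ p ∈ antidiagonal n,
      z ^ p.2 * z⁻¹ ^ p.1 * (qPoch (a * z) q p.1 * qPoch (b * z) q p.1 * qPoch (c / z) q p.2
        * qPoch (d / z) q p.2 * qPoch (a * b * q ^ p.1) q p.2 * qPoch (c * d * q ^ p.2) q p.1)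
        / (qPoch q q p.1 * qPoch q q p.2) := by
  set S := fun j m => qPoch (q ^ (-(n : ℤ))) q (j + m) * q ^ (j + m)
    * saalschutzTerm (b * z) (q ^ (1 - (n : ℤ)) / (c * d)) (q ^ ((n : ℤ) - 1) * (a * c * d) / z)
      q j m
    * (qPoch (a * z) q (j + m) * (qPoch (a * b * q ^ (j + m)) q (n - (j + m))
      * qPoch (a * c * q ^ (j + m)) q (n - (j + m)) * qPoch (a * d * q ^ (j + m)) q (n - (j + m))))
    with hS
  have hexpand : askeyWilson n ((z + z⁻¹) / 2) a b c d q
      = (a ^ n)⁻¹ * ∑ k ∈ range (n + 1), ∑ j ∈ range (k + 1), S j (k - j) := by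
    rw [askeyWilson_eq_sum_awWeight n hz]
    congr 1
    refine sum_congr rfl fun k _ => ?_
    rw [← Nat.sum_antidiagonal_eq_sum_range_succ S k, mul_comm (qPoch (a * z) q k),
      ← mul_assoc (awWeight _ q n k), awWeight_mul_qPoch_div_eq_sum hq0 hq hz hc hd,
      mul_sum, sum_mul, sum_mul]
    refine sum_congr rfl fun p hp => ?_
    rw [hS, ← mem_antidiagonal.1 hp]
    ring
  rw [hexpand, sum_range_diag_flip, Nat.sum_antidiagonal_eq_sum_range_succ_mk, mul_sum, mul_sum]
  refine sum_congr rfl fun j hj => ?_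
  obtain ⟨l, rfl⟩ := Nat.exists_eq_add_of_le (Nat.lt_succ_iff.1 (mem_range.1 hj))
  have hinner := sum_saalschutzTerm_mul_eq hq0 hq hz ha hc hd b j l
  have hl := hq.qPoch_ne_zero l
  have hprefactor := eq_div_of_mul_eq hl (convolution_prefactor hq0 hc hd a z j l)
  rw [hprefactor] at hinner
  rw [show j + l + 1 - j = l + 1 by omega, show j + l - j = l by omega]
  simp only [hS, Nat.add_sub_add_left]
  rw [hinner]
  field_simp

end Convolution

section Symmetry

variable {a b c d z : ℂ}

theorem askeyWilson_swap_left (hq0 : q ≠ 0) (hq : QRegular q q) (n : ℕ) (hz : z ≠ 0)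
    (ha : a ≠ 0) (hb : b ≠ 0) (hc : c ≠ 0) (hd : d ≠ 0) :
    askeyWilson n ((z + z⁻¹) / 2) a b c d q = askeyWilson n ((z + z⁻¹) / 2) b a c d q := by
  rw [askeyWilson_eq_convolution hq0 hq n hz ha hc hd,
    askeyWilson_eq_convolution hq0 hq n hz hb hc hd, mul_comm b a]
  congr 1
  refine sum_congr rfl fun p _ => ?_
  ring

theorem askeyWilson_swap_middle (n : ℕ) (hz : z ≠ 0) (a b c d q : ℂ) :
    askeyWilson n ((z + z⁻¹) / 2) a b c d q = askeyWilson n ((z + z⁻¹) / 2) a c b d q := by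
  rw [askeyWilson_eq_sum_awWeight n hz, askeyWilson_eq_sum_awWeight n hz, mul_right_comm a c b]
  congr 1
  refine sum_congr rfl fun k _ => ?_
  ring

theorem askeyWilson_rotate (hq0 : q ≠ 0) (hq : QRegular q q) (n : ℕ) (hz : z ≠ 0)
    (ha : a ≠ 0) (hb : b ≠ 0) (hc : c ≠ 0) (hd : d ≠ 0) :
    askeyWilson n ((z + z⁻¹) / 2) a b c d q = askeyWilson n ((z + z⁻¹) / 2) c a b d q := by
  rw [askeyWilson_swap_middle n hz a b c d q, askeyWilson_swap_left hq0 hq n hz ha hc hb hd]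

end Symmetry

/-! ### Bailey inversion -/

theorem QRegular.of_div {s : ℂ} (hq0 : q ≠ 0) (h : QRegular (s / q) q) : QRegular s q := by
  simpa [div_mul_cancel₀ s hq0] using h.mul_pow 1

theorem sum_veryWellPoised_partial (hq0 : q ≠ 0) (hq : QRegular q q) {A : ℂ} {N : ℕ}
    (hA : QRegular (A * q ^ (N + 1)) q) (M : ℕ) :
    (1 - q ^ (-(N : ℤ))) * ∑ i ∈ range (M + 1), q ^ (N * i)
        * (qPoch (q ^ (-(N : ℤ))) q i * (1 - A * q ^ (2 * i)) * qPoch A q i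
          / (qPoch q q i * qPoch (A * q ^ (N + 1)) q i))
      = q ^ (N * M) * (qPoch (q ^ (-(N : ℤ))) q (M + 1) * qPoch A q (M + 1)
        / (qPoch q q M * qPoch (A * q ^ (N + 1)) q M)) := by
  induction M with
  | zero => simp [qPoch]
  | succ M ih =>
    have hM := hq.qPoch_ne_zero M
    have hAM := hA.qPoch_ne_zero M
    have hM' := hq.one_sub_mul_pow_ne_zero M
    have hAM' := hA.one_sub_mul_pow_ne_zero M
    have hN := pow_ne_zero N hq0
    have hpow : q ^ (2 * (M + 1)) = (q ^ M * q) ^ 2 := by rw [← pow_succ, ← pow_mul, mul_comm]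
    rw [sum_range_succ, mul_add, ih, mul_add_one, pow_add q (N * M), hpow, qPoch_succ _ _ (M + 1),
      qPoch_succ A q (M + 1), qPoch_succ q q M, qPoch_succ (A * q ^ (N + 1)) q M, zpow_neg,
      zpow_natCast]
    simp only [pow_succ q] at *
    generalize qPoch (A * (q ^ N * q)) q M = B at *
    generalize qPoch q q M = C at *
    generalize q ^ M = x at *
    generalize q ^ N = w at *
    generalize hD : 1 - q * x = D at *
    generalize hD' : 1 - A * (w * q) * x = D' at *
    field_simp
    rw [← hD, ← hD']
    ring

theorem sum_veryWellPoised (hq0 : q ≠ 0) (hq : QRegular q q) {A : ℂ} {N : ℕ}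
    (hA : QRegular (A * q ^ (N + 1)) q) :
    ∑ i ∈ range (N + 1), q ^ (N * i) * (qPoch (q ^ (-(N : ℤ))) q i * (1 - A * q ^ (2 * i))
        * qPoch A q i / (qPoch q q i * qPoch (A * q ^ (N + 1)) q i))
      = if N = 0 then 1 - A else 0 := by
  split_ifs with hN
  · subst hN
    simp [qPoch]
  · have h := sum_veryWellPoised_partial hq0 hq hA N
    rw [qPoch_neg_pow_eq_zero hq0 N.lt_succ_self, zero_mul, zero_div, mul_zero] at h
    obtain ⟨M, rfl⟩ := Nat.exists_eq_succ_of_ne_zero hN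
    refine (mul_eq_zero.1 h).resolve_left (sub_ne_zero.2 fun h1 => hq M ?_)
    rwa [zpow_neg, zpow_natCast, eq_comm, inv_eq_one, pow_succ'] at h1

/-- The very-well-poised factor `(s;q)_{2k} (s/q;q)_k / ((s/q;q)_{2k} (q;q)_k)`, in which the first
quotient is `(1 - s q^{2k-1}) / (1 - s/q)`. -/
noncomputable def veryWellPoised (s q : ℂ) (k : ℕ) : ℂ :=
  qPoch s q (2 * k) * qPoch (s / q) q k / (qPoch (s / q) q (2 * k) * qPoch q q k)

theorem veryWellPoised_eq (hq0 : q ≠ 0) {s : ℂ} (hs : QRegular (s / q) q) (k : ℕ) :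
    veryWellPoised s q k
      = (1 - s / q * q ^ (2 * k)) / (1 - s / q) * (qPoch (s / q) q k / qPoch q q k) := by
  have h0 := hs.one_sub_mul_pow_ne_zero 0
  rw [pow_zero, mul_one] at h0
  have hratio : qPoch s q (2 * k) / qPoch (s / q) q (2 * k)
      = (1 - s / q * q ^ (2 * k)) / (1 - s / q) := by
    rw [div_eq_div_iff (hs.qPoch_ne_zero _) h0, mul_comm (1 - _), ← qPoch_succ, qPoch_succ',
      div_mul_cancel₀ s hq0, mul_comm]
  rw [veryWellPoised, mul_div_mul_comm, hratio]

/-- The entries of the lower triangular matrix inverse, up to the factor `(s;q)_m`, to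
`(awWeight s q k j)_{k, j}`. -/
noncomputable def inverseWeight (s q : ℂ) (m k : ℕ) : ℂ :=
  q ^ (m * k) * (qPoch (q ^ (-(m : ℤ))) q k / qPoch (s * q ^ m) q k) * veryWellPoised s q k

theorem inverseWeight_mul_awWeight (hq0 : q ≠ 0) (hq : QRegular q q) {s : ℂ}
    (hs : QRegular (s / q) q) (j N i : ℕ) :
    inverseWeight s q (j + N) (j + i) * awWeight s q (j + i) j
      = qPoch q q (j + N) * qPoch (s / q) q (2 * j)
          / (qPoch q q N * qPoch q q j * qPoch (s * q ^ (j + N)) q j * (1 - s / q))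
        * (q ^ (N * i) * (qPoch (q ^ (-(N : ℤ))) q i * (1 - s / q * q ^ (2 * j) * q ^ (2 * i))
          * qPoch (s / q * q ^ (2 * j)) q i
          / (qPoch q q i * qPoch (s / q * q ^ (2 * j) * q ^ (N + 1)) q i))) := by
  have hN := hq.qPoch_ne_zero N
  have hj := hq.qPoch_ne_zero j
  have hi := hq.qPoch_ne_zero i
  have hji := hq.qPoch_ne_zero (j + i)
  obtain ⟨r, rfl⟩ : ∃ r, s = r * q := ⟨s / q, (div_mul_cancel₀ s hq0).symm⟩
  rw [inverseWeight, awWeight, veryWellPoised_eq hq0 hs]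
  rw [mul_div_cancel_right₀ r hq0] at *
  have hbase : r * q * q ^ (j + N) * q ^ j = r * q ^ (2 * j) * q ^ (N + 1) := by ring
  have hbase' : q ^ (((j + i : ℕ) : ℤ) - 1) * (r * q) = r * q ^ (j + i) := by
    rw [zpow_sub_one₀ hq0, zpow_natCast]
    field_simp
  have hr : qPoch r q (j + i) * qPoch (r * q ^ (j + i)) q j
      = qPoch r q (2 * j) * qPoch (r * q ^ (2 * j)) q i := by
    rw [← qPoch_add, ← qPoch_add]
    congr 1
    ring
  have hpow : q ^ ((j + N) * (j + i)) * q ^ j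
      = q ^ ((N + 1) * j + j.choose 2) * q ^ (N * i) * q ^ ((i + 1) * j + j.choose 2) := by
    simp only [← pow_add]
    congr 1
    qify
    push_cast [Nat.cast_choose_two]
    ring
  rw [qPoch_self_add hq0] at hji
  have hU := right_ne_zero_of_mul (left_ne_zero_of_mul hji)
  rw [qPoch_add (q ^ (-((j + N : ℕ) : ℤ))), zpow_neg_add_mul_pow hq0,
    qPoch_add (r * q * q ^ (j + N)), hbase, hbase', qPoch_self_add hq0 j N, qPoch_self_add hq0 j i]
  generalize qPoch (q ^ (-((j + i : ℕ) : ℤ))) q j = U at *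
  generalize qPoch (q ^ (-((j + N : ℕ) : ℤ))) q j = V
  have hsign : ((-1 : ℂ) ^ j) ^ 2 = 1 := by rw [← pow_mul, mul_comm, pow_mul, neg_one_sq, one_pow]
  rw [show q ^ (2 * (j + i)) = q ^ (2 * j) * q ^ (2 * i) by ring]
  field_simp
  rw [hsign]
  congr 1
  linear_combination (V * qPoch (q ^ (-(N : ℤ))) q i * (1 - r * q ^ (2 * j) * q ^ (2 * i)))
    * (qPoch r q (j + i) * qPoch (r * q ^ (j + i)) q j * hpow
      + q ^ ((N + 1) * j + j.choose 2) * q ^ (N * i) * q ^ ((i + 1) * j + j.choose 2) * hr)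

theorem sum_inverseWeight_mul_awWeight (hq0 : q ≠ 0) (hq : QRegular q q) {s : ℂ}
    (hs : QRegular (s / q) q) {j m : ℕ} (hjm : j ≤ m) :
    ∑ k ∈ range (m + 1), inverseWeight s q m k * awWeight s q k j
      = if j = m then qPoch s q m else 0 := by
  obtain ⟨N, rfl⟩ := Nat.exists_eq_add_of_le hjm
  have hlow : ∑ k ∈ range j, inverseWeight s q (j + N) k * awWeight s q k j = 0 :=
    sum_eq_zero fun k hk => by
      rw [awWeight, qPoch_neg_pow_eq_zero hq0 (mem_range.1 hk)]
      ring
  have hA : QRegular (s / q * q ^ (2 * j) * q ^ (N + 1)) q :=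
    (hs.mul_pow _).mul_pow _
  rw [add_assoc, sum_range_add, hlow, zero_add,
    sum_congr rfl fun i _ => inverseWeight_mul_awWeight hq0 hq hs j N i, ← mul_sum,
    sum_veryWellPoised hq0 hq hA]
  by_cases hN : N = 0
  · subst hN
    have h0 := hs.one_sub_mul_pow_ne_zero 0
    rw [pow_zero, mul_one] at h0
    have hj := hq.qPoch_ne_zero j
    have hden := ((hs.of_div hq0).mul_pow j).qPoch_ne_zero j
    have hsucc := qPoch_succ (s / q) q (2 * j)
    rw [qPoch_succ', div_mul_cancel₀ s hq0, two_mul, qPoch_add] at hsucc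
    simp only [add_zero, if_true, qPoch_zero, one_mul, two_mul] at hsucc ⊢
    generalize s / q = r at *
    field_simp
    linear_combination -hsucc
  · simp [hN]

theorem bailey_inversion (hq0 : q ≠ 0) (hq : QRegular q q) {s : ℂ} (hs : QRegular (s / q) q)
    (φ : ℕ → ℂ) (m : ℕ) :
    ∑ k ∈ range (m + 1), inverseWeight s q m k * ∑ j ∈ range (k + 1), awWeight s q k j * φ j
      = qPoch s q m * φ m := by
  have hextend : ∀ k ∈ range (m + 1), ∑ j ∈ range (k + 1), awWeight s q k j * φ j
      = ∑ j ∈ range (m + 1), awWeight s q k j * φ j := fun k hk =>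
    sum_subset (range_subset_range.2 (mem_range.1 hk)) fun j _ hj => by
      rw [awWeight, qPoch_neg_pow_eq_zero hq0 (by simpa [Nat.lt_succ_iff] using hj)]
      ring
  calc _ = ∑ j ∈ range (m + 1), (∑ k ∈ range (m + 1), inverseWeight s q m k * awWeight s q k j)
          * φ j := by
        simp only [sum_mul, mul_assoc]
        rw [sum_comm]
        refine sum_congr rfl fun k hk => ?_
        rw [hextend k hk, mul_sum]
    _ = ∑ j ∈ range (m + 1), if j = m then qPoch s q m * φ j else 0 :=
        sum_congr rfl fun j hj => by
          rw [sum_inverseWeight_mul_awWeight hq0 hq hs (Nat.lt_succ_iff.1 (mem_range.1 hj)),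
            ite_mul, zero_mul]
    _ = _ := by rw [sum_ite_eq' _ m, if_pos (self_mem_range_succ m)]

/-- The factor of `p_k(x; a, b, e, f | q)` in the expansions that depends neither on `x` nor on the
expanded function. -/
noncomputable def expansionWeight (a b e f q : ℂ) (k : ℕ) : ℂ :=
  veryWellPoised (a * b * e * f) q k / (qPoch (a * e) q k * qPoch (b * e) q k * qPoch (e * f) q k)

theorem expansionWeight_mul_askeyWilson {z a b e f : ℂ} (hz : z ≠ 0) (he : e ≠ 0)
    (hae : QRegular (a * e) q) (hbe : QRegular (b * e) q) (hef : QRegular (e * f) q) (k : ℕ) :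
    e ^ k * (expansionWeight a b e f q k * askeyWilson k ((z + z⁻¹) / 2) e a b f q)
      = veryWellPoised (a * b * e * f) q k * ∑ j ∈ range (k + 1), awWeight (a * b * e * f) q k j
        * (qPoch (e * z) q j * qPoch (e / z) q j
          / (qPoch (a * e) q j * qPoch (b * e) q j * qPoch (e * f) q j)) := by
  rw [expansionWeight, askeyWilson_eq_sum_awWeight k hz, mul_sum, mul_sum, mul_sum, mul_sum]
  refine sum_congr rfl fun j hj => ?_
  have hjk := Nat.lt_succ_iff.1 (mem_range.1 hj)
  have h1 := hae.qPoch_ne_zero k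
  have h2 := hbe.qPoch_ne_zero k
  have h3 := hef.qPoch_ne_zero k
  rw [qPoch_split _ _ hjk] at h1 h2 h3
  rw [mul_comm e a, mul_comm e b, show a * e * b * f = a * b * e * f by ring,
    qPoch_split (a * e) q hjk, qPoch_split (b * e) q hjk, qPoch_split (e * f) q hjk]
  simp only [mul_ne_zero_iff] at h1 h2 h3
  obtain ⟨h1, h1'⟩ := h1
  obtain ⟨h2, h2'⟩ := h2
  obtain ⟨h3, h3'⟩ := h3
  field_simp

theorem sum_expansionWeight_mul_askeyWilson (hq0 : q ≠ 0) (hq : QRegular q q) {z a b e f : ℂ}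
    (hz : z ≠ 0) (he : e ≠ 0) (hae : QRegular (a * e) q) (hbe : QRegular (b * e) q)
    (hef : QRegular (e * f) q) (hs : QRegular (a * b * e * f / q) q) (m : ℕ) :
    ∑ k ∈ range (m + 1), (e * q ^ m) ^ k
        * (qPoch (q ^ (-(m : ℤ))) q k / qPoch (a * b * e * f * q ^ m) q k)
        * (expansionWeight a b e f q k * askeyWilson k ((z + z⁻¹) / 2) e a b f q)
      = qPoch (a * b * e * f) q m * (qPoch (e * z) q m * qPoch (e / z) q m
        / (qPoch (a * e) q m * qPoch (b * e) q m * qPoch (e * f) q m)) := by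
  rw [← bailey_inversion hq0 hq hs (fun j => qPoch (e * z) q j * qPoch (e / z) q j
    / (qPoch (a * e) q j * qPoch (b * e) q j * qPoch (e * f) q j))]
  refine sum_congr rfl fun k _ => ?_
  rw [inverseWeight, mul_assoc _ (veryWellPoised _ _ _),
    ← expansionWeight_mul_askeyWilson hz he hae hbe hef]
  ring

/-! ### Growth estimates -/

theorem prod_one_add_geometric_le {r t : ℝ} (hr0 : 0 ≤ r) (hr1 : r < 1) (ht : 0 ≤ t) (n : ℕ) :
    ∏ j ∈ range n, (1 + t * r ^ j) ≤ Real.exp (t / (1 - r)) := by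
  refine (Real.prod_one_add_le_exp_sum (f := fun j : ℕ => t * r ^ j) (range n)
    fun j => by positivity).trans (Real.exp_le_exp.2 ?_)
  rw [← mul_sum, div_eq_mul_inv, ← tsum_geometric_of_lt_one hr0 hr1]
  gcongr
  exact (summable_geometric_of_lt_one hr0 hr1).sum_le_tsum _ fun j _ => pow_nonneg hr0 j

theorem norm_prod_sub_mul_pow_le (hq1 : ‖q‖ < 1) {u v : ℂ} {r t : ℝ} (hu : ‖u‖ ≤ r) (ht : 0 ≤ t)
    (hv : ‖v‖ ≤ r * t) (n : ℕ) :
    ‖∏ j ∈ range n, (u - v * q ^ j)‖ ≤ r ^ n * Real.exp (t / (1 - ‖q‖)) := by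
  have hr : 0 ≤ r := (norm_nonneg u).trans hu
  calc _ ≤ ∏ j ∈ range n, r * (1 + t * ‖q‖ ^ j) := by
        rw [norm_prod]
        refine prod_le_prod (fun j _ => norm_nonneg _) fun j _ => (norm_sub_le _ _).trans ?_
        rw [norm_mul, norm_pow, mul_add, mul_one, ← mul_assoc]
        gcongr
    _ = r ^ n * ∏ j ∈ range n, (1 + t * ‖q‖ ^ j) := by
        rw [prod_mul_distrib, prod_const, card_range]
    _ ≤ _ := by
        gcongr
        exact prod_one_add_geometric_le (norm_nonneg q) hq1 ht n

theorem norm_qPoch_le (hq1 : ‖q‖ < 1) {u : ℂ} {t : ℝ} (hu : ‖u‖ ≤ t) (n : ℕ) :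
    ‖qPoch u q n‖ ≤ Real.exp (t / (1 - ‖q‖)) := by
  simpa [qPoch] using norm_prod_sub_mul_pow_le hq1 (u := 1) (r := 1) norm_one.le
    ((norm_nonneg u).trans hu) (hu.trans_eq (one_mul t).symm) n

theorem norm_qPochInf_le (hq1 : ‖q‖ < 1) {u : ℂ} {t : ℝ} (hu : ‖u‖ ≤ t) :
    ‖qPochInf u q‖ ≤ Real.exp (t / (1 - ‖q‖)) :=
  le_of_tendsto (tendsto_qPoch_qPochInf u hq1).norm
    (Filter.Eventually.of_forall fun n => norm_qPoch_le hq1 hu n)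

theorem norm_mul_pow_le (hq1 : ‖q‖ < 1) (u : ℂ) (m : ℕ) : ‖u * q ^ m‖ ≤ ‖u‖ := by
  rw [norm_mul, norm_pow]
  exact mul_le_of_le_one_right (norm_nonneg u) (pow_le_one₀ (norm_nonneg q) hq1.le)

theorem qPochInf_eq_mul (hq1 : ‖q‖ < 1) (u : ℂ) (n : ℕ) :
    qPochInf u q = qPoch u q n * qPochInf (u * q ^ n) q := by
  have h := (Filter.tendsto_add_atTop_iff_nat n).2 (tendsto_qPoch_qPochInf u hq1)
  refine tendsto_nhds_unique h
    (((tendsto_qPoch_qPochInf (u * q ^ n) hq1).const_mul (qPoch u q n)).congr fun m => ?_)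
  rw [← qPoch_add, add_comm]

theorem QRegular.qPochInf_ne_zero {u : ℂ} (h : QRegular u q) (hq1 : ‖q‖ < 1) :
    qPochInf u q ≠ 0 := by
  have hsum : Summable fun j : ℕ => ‖-(u * q ^ j)‖ := by
    simpa [norm_mul, norm_pow] using
      (summable_geometric_of_lt_one (norm_nonneg q) hq1).mul_left ‖u‖
  have := tprod_one_add_ne_zero_of_summable (f := fun j : ℕ => -(u * q ^ j))
    (fun j => by simpa only [← sub_eq_add_neg] using h.one_sub_mul_pow_ne_zero j) hsum
  simpa only [← sub_eq_add_neg, qPochInf] using this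

@[fun_prop]
theorem differentiable_qPochInf (hq1 : ‖q‖ < 1) : Differentiable ℂ fun u => qPochInf u q := by
  intro u
  have hprod : HasProdLocallyUniformlyOn (fun (j : ℕ) (w : ℂ) => 1 + -(w * q ^ j))
      (fun w => ∏' j : ℕ, (1 + -(w * q ^ j))) (Metric.ball (0 : ℂ) (‖u‖ + 1)) := by
    refine Summable.hasProdLocallyUniformlyOn_nat_one_add Metric.isOpen_ball
      ((summable_geometric_of_lt_one (norm_nonneg q) hq1).mul_left (‖u‖ + 1))
      (Filter.Eventually.of_forall fun j w hw => ?_) (fun j => by fun_prop)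
    rw [norm_neg, norm_mul, norm_pow]
    have : ‖w‖ < ‖u‖ + 1 := by simpa using hw
    gcongr
  have hdiff := hprod.differentiableOn (Filter.Eventually.of_forall fun s => by
    simpa [Finset.prod_fn] using DifferentiableOn.finsetProd (fun _ _ => by fun_prop))
    Metric.isOpen_ball
  have := hdiff.differentiableAt (x := u) (Metric.isOpen_ball.mem_nhds (by simp))
  simpa only [← sub_eq_add_neg, qPochInf] using this

theorem exists_norm_inv_qPoch_self_le (hq : QRegular q q) (hq1 : ‖q‖ < 1) :
    ∃ C : ℝ, ∀ n, ‖(qPoch q q n)⁻¹‖ ≤ C := by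
  have h := (tendsto_qPoch_qPochInf q hq1).inv₀ (hq.qPochInf_ne_zero hq1)
  obtain ⟨C, hC⟩ := (Metric.isBounded_range_of_tendsto _ h).exists_norm_le
  exact ⟨C, fun n => hC _ ⟨n, rfl⟩⟩

theorem exists_norm_askeyWilson_le (hq0 : q ≠ 0) (hq1 : ‖q‖ < 1) {z a b c d : ℂ}
    (hz : z ≠ 0) (ha : a ≠ 0) (hc : c ≠ 0) (hd : d ≠ 0) :
    ∃ C : ℝ, ∀ n, ‖askeyWilson n ((z + z⁻¹) / 2) a b c d q‖
      ≤ C * ((n + 1) * max ‖z‖ ‖z⁻¹‖ ^ n) := by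
  have hq := QRegular.of_norm_lt_one hq1 hq1
  obtain ⟨C, hC⟩ := exists_norm_inv_qPoch_self_le hq hq1
  have hC0 : 0 ≤ C := (norm_nonneg _).trans (hC 0)
  set M := max ‖z‖ ‖z⁻¹‖
  set B : ℂ → ℝ := fun u => Real.exp (‖u‖ / (1 - ‖q‖))
  have hB (u n) : ‖qPoch u q n‖ ≤ B u := norm_qPoch_le hq1 le_rfl n
  have hB' (u m n) : ‖qPoch (u * q ^ m) q n‖ ≤ B u :=
    norm_qPoch_le hq1 (norm_mul_pow_le hq1 u m) n
  set K := B (a * z) * B (b * z) * B (c / z) * B (d / z) * B (a * b) * B (c * d) * (C * C)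
  refine ⟨B q * K, fun n => ?_⟩
  rw [askeyWilson_eq_convolution hq0 hq n hz ha hc hd, norm_mul]
  have hterm : ∀ p ∈ antidiagonal n, ‖z ^ p.2 * z⁻¹ ^ p.1
      * (qPoch (a * z) q p.1 * qPoch (b * z) q p.1 * qPoch (c / z) q p.2 * qPoch (d / z) q p.2
        * qPoch (a * b * q ^ p.1) q p.2 * qPoch (c * d * q ^ p.2) q p.1)
      / (qPoch q q p.1 * qPoch q q p.2)‖ ≤ M ^ n * K := by
    intro p hp
    have hM : ‖z‖ ^ p.2 * ‖z⁻¹‖ ^ p.1 ≤ M ^ n := by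
      rw [← mem_antidiagonal.1 hp, add_comm, pow_add]
      gcongr
      exacts [le_max_left _ _, le_max_right _ _]
    rw [mul_div_assoc, div_eq_mul_inv, mul_inv]
    simp only [norm_mul, norm_pow, K]
    gcongr
    exacts [hB _ _, hB _ _, hB _ _, hB _ _, hB' _ _ _, hB' _ _ _, hC _, hC _]
  calc _ ≤ B q * ((n + 1) * (M ^ n * K)) := by
        gcongr
        · exact hB q n
        · refine (norm_sum_le_of_le _ hterm).trans_eq ?_
          rw [sum_const, Nat.card_antidiagonal, nsmul_eq_mul]
          push_cast
          rfl
    _ = _ := by ring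

theorem exists_norm_expansionWeight_le (hq1 : ‖q‖ < 1) {a b e f : ℂ} (hae : QRegular (a * e) q)
    (hbe : QRegular (b * e) q) (hef : QRegular (e * f) q) (hs : QRegular (a * b * e * f / q) q) :
    ∃ C : ℝ, ∀ k, ‖expansionWeight a b e f q k‖ ≤ C := by
  have hdouble := Filter.tendsto_id.const_mul_atTop' (zero_lt_two' ℕ)
  have hlim (u : ℂ) := tendsto_qPoch_qPochInf u hq1
  have hne := fun {u} (hu : QRegular u q) => hu.qPochInf_ne_zero hq1
  have h := ((((hlim (a * b * e * f)).comp hdouble).mul (hlim (a * b * e * f / q))).div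
    (((hlim (a * b * e * f / q)).comp hdouble).mul (hlim q))
    (mul_ne_zero (hne hs) (hne (.of_norm_lt_one hq1 hq1)))).div
    (((hlim (a * e)).mul (hlim (b * e))).mul (hlim (e * f)))
    (mul_ne_zero (mul_ne_zero (hne hae) (hne hbe)) (hne hef))
  obtain ⟨C, hC⟩ := (Metric.isBounded_range_of_tendsto _ h).exists_norm_le
  exact ⟨C, fun k => hC _ ⟨k, rfl⟩⟩

/-! ### `q`-Newton series -/

theorem prod_sub_mul_pow_eq {c : ℂ} (hc : c ≠ 0) (e q : ℂ) (k : ℕ) :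
    ∏ i ∈ range k, (c - e * q ^ i) = c ^ k * qPoch (e / c) q k := by
  calc _ = ∏ i ∈ range k, c * (1 - e / c * q ^ i) := prod_congr rfl fun i _ => by field_simp
    _ = _ := by rw [prod_mul_distrib, prod_const, card_range, qPoch]

/-- The `k`-th term of the `q`-analogue of the Newton basis with nodes `e, eq, eq², …`, normalised
by an entire factor. -/
noncomputable def qNewtonTerm (e g q : ℂ) (k : ℕ) (w : ℂ) : ℂ :=
  (∏ i ∈ range k, (w - e * q ^ i)) * qPochInf (g * w * q ^ k) q

theorem norm_qNewtonTerm_le (hq1 : ‖q‖ < 1) (e g : ℂ) {w : ℂ} {r : ℝ} (hr : 0 < r)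
    (hw : ‖w‖ ≤ r) (k : ℕ) :
    ‖qNewtonTerm e g q k w‖
      ≤ r ^ k * (Real.exp (‖e‖ / r / (1 - ‖q‖)) * Real.exp (‖g‖ * r / (1 - ‖q‖))) := by
  rw [qNewtonTerm, norm_mul, ← mul_assoc]
  gcongr
  · exact norm_prod_sub_mul_pow_le hq1 hw (by positivity) (mul_div_cancel₀ _ hr.ne').ge k
  · refine norm_qPochInf_le hq1 ((norm_mul_pow_le hq1 _ k).trans ?_)
    rw [norm_mul]
    gcongr

theorem differentiable_qNewtonTerm (hq1 : ‖q‖ < 1) (e g : ℂ) (k : ℕ) :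
    Differentiable ℂ (qNewtonTerm e g q k) := by
  unfold qNewtonTerm
  fun_prop (disch := assumption)

theorem qNewtonTerm_node_eq_zero {e g : ℂ} {m k : ℕ} (hmk : m < k) :
    qNewtonTerm e g q k (e * q ^ m) = 0 := by
  rw [qNewtonTerm, prod_eq_zero (mem_range.2 hmk) (sub_self _), zero_mul]

theorem eqOn_ball_of_eq_geometric (hq0 : q ≠ 0) (hq1 : ‖q‖ < 1) {e : ℂ} (he : e ≠ 0) {r : ℝ}
    (hr : 0 < r) {F G : ℂ → ℂ} (hF : DifferentiableOn ℂ F (Metric.ball 0 r))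
    (hG : DifferentiableOn ℂ G (Metric.ball 0 r)) (h : ∀ m : ℕ, F (e * q ^ m) = G (e * q ^ m)) :
    Set.EqOn F G (Metric.ball 0 r) := by
  have hlim : Filter.Tendsto (fun m : ℕ => e * q ^ m) Filter.atTop (nhdsWithin 0 {0}ᶜ) := by
    refine tendsto_nhdsWithin_iff.2 ⟨?_, Filter.Eventually.of_forall fun m =>
      mul_ne_zero he (pow_ne_zero _ hq0)⟩
    simpa using (tendsto_pow_atTop_nhds_zero_of_norm_lt_one hq1).const_mul e
  exact (hF.analyticOnNhd Metric.isOpen_ball).eqOn_of_preconnected_of_frequently_eq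
    (hG.analyticOnNhd Metric.isOpen_ball) (convex_ball 0 r).isPreconnected
    (Metric.mem_ball_self hr) (hlim.frequently (Filter.Eventually.of_forall h).frequently)

theorem summable_succ_mul_geometric {x : ℝ} (hx : ‖x‖ < 1) :
    Summable fun k : ℕ => ((k : ℝ) + 1) * x ^ k :=
  ((summable_pow_mul_geometric_of_norm_lt_one 1 hx).add
    (summable_geometric_of_norm_lt_one hx)).congr fun k => by ring

theorem hasSum_qNewtonTerm_mul (hq0 : q ≠ 0) (hq1 : ‖q‖ < 1) {e : ℂ} (he : e ≠ 0) (g : ℂ)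
    {t : ℕ → ℂ} {C M : ℝ} (hM : 0 < M) (ht : ∀ k, ‖t k‖ ≤ C * ((k + 1) * M ^ k)) {G : ℂ → ℂ}
    (hG : DifferentiableOn ℂ G (Metric.ball 0 M⁻¹))
    (hnode : ∀ m : ℕ, ∑ k ∈ range (m + 1), qNewtonTerm e g q k (e * q ^ m) * t k = G (e * q ^ m))
    {c : ℂ} (hc : ‖c‖ < M⁻¹) :
    HasSum (fun k => qNewtonTerm e g q k c * t k) (G c) := by
  obtain ⟨r, hcr, hrM⟩ := exists_between hc
  have hr : 0 < r := (norm_nonneg c).trans_lt hcr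
  have hrM1 : ‖r * M‖ < 1 := by
    rw [Real.norm_of_nonneg (by positivity)]
    exact (lt_inv_mul_iff₀' hM).1 (by simpa using hrM)
  set K := Real.exp (‖e‖ / r / (1 - ‖q‖)) * Real.exp (‖g‖ * r / (1 - ‖q‖))
  have hsumm := (summable_succ_mul_geometric hrM1).mul_left (K * C)
  have hbound (k : ℕ) (w : ℂ) (hw : w ∈ Metric.ball 0 r) :
      ‖qNewtonTerm e g q k w * t k‖ ≤ K * C * ((k + 1) * (r * M) ^ k) := by
    have hwr : ‖w‖ ≤ r := by simpa using (Metric.mem_ball.1 hw).le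
    calc _ ≤ r ^ k * K * (C * ((k + 1) * M ^ k)) := by
          rw [norm_mul]
          gcongr
          exacts [norm_qNewtonTerm_le hq1 e g hr hwr k, ht k]
      _ = _ := by ring
  have hF : DifferentiableOn ℂ (fun w => ∑' k, qNewtonTerm e g q k w * t k) (Metric.ball 0 r) :=
    Complex.differentiableOn_tsum_of_summable_norm hsumm
      (fun k => ((differentiable_qNewtonTerm hq1 e g k).mul_const _).differentiableOn)
      Metric.isOpen_ball hbound
  have hcball : c ∈ Metric.ball 0 r := by simpa using hcr
  have heq := eqOn_ball_of_eq_geometric hq0 hq1 he hr hF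
    (hG.mono (Metric.ball_subset_ball hrM.le)) fun m => by
      rw [← hnode m, tsum_eq_sum fun k hk => ?_]
      rw [qNewtonTerm_node_eq_zero (by simpa [Nat.lt_succ_iff] using hk), zero_mul]
  rw [← heq hcball]
  exact (Summable.of_norm_bounded hsumm fun k => hbound k c hcball).hasSum

/-- The sum, as a function of `w`, of the `q`-Newton series whose coefficients are the weighted
Askey--Wilson polynomials. -/
noncomputable def expansionRatio (a b e f z q w : ℂ) : ℂ :=
  qPochsInf [a * w, b * w, w * f, a * b * e * f, e * z, e / z] q
    / qPochsInf [a * e, b * e, e * f, w * z, w / z] q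

theorem norm_lt_inv_max_iff {z : ℂ} (hz : z ≠ 0) {w : ℂ} :
    ‖w‖ < (max ‖z‖ ‖z⁻¹‖)⁻¹ ↔ ‖w * z‖ < 1 ∧ ‖w / z‖ < 1 := by
  rw [← one_div, lt_div_iff₀ (lt_max_of_lt_left (norm_pos_iff.2 hz)),
    mul_max_of_nonneg _ _ (norm_nonneg w), max_lt_iff, ← norm_mul, ← norm_mul, div_eq_mul_inv]

theorem differentiableOn_expansionRatio (hq1 : ‖q‖ < 1) {z a b e f : ℂ} (hz : z ≠ 0)
    (hae : QRegular (a * e) q) (hbe : QRegular (b * e) q) (hef : QRegular (e * f) q) :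
    DifferentiableOn ℂ (expansionRatio a b e f z q) (Metric.ball 0 (max ‖z‖ ‖z⁻¹‖)⁻¹) := by
  intro w hw
  obtain ⟨hwz, hwz'⟩ := (norm_lt_inv_max_iff hz).1 (mem_ball_zero_iff.1 hw)
  have h1 := hae.qPochInf_ne_zero hq1
  have h2 := hbe.qPochInf_ne_zero hq1
  have h3 := hef.qPochInf_ne_zero hq1
  have h4 := (QRegular.of_norm_lt_one hq1 hwz).qPochInf_ne_zero hq1
  have h5 := (QRegular.of_norm_lt_one hq1 hwz').qPochInf_ne_zero hq1
  rw [div_eq_mul_inv] at h5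
  unfold expansionRatio
  simp only [qPochsInf, List.map_cons, List.map_nil, List.prod_cons, List.prod_nil,
    div_eq_mul_inv _ z]
  refine (DifferentiableAt.fun_div ?_ ?_ (by simp [h1, h2, h3, h4, h5])).differentiableWithinAt <;>
    fun_prop (disch := assumption)

theorem expansionRatio_node (hq1 : ‖q‖ < 1) {z a b e f : ℂ} (hae : QRegular (a * e) q)
    (hbe : QRegular (b * e) q) (hef : QRegular (e * f) q) (hez : QRegular (e * z) q)
    (hez' : QRegular (e / z) q) (m : ℕ) :
    expansionRatio a b e f z q (e * q ^ m)
      = qPochInf (a * b * e * f) q * (qPoch (e * z) q m * qPoch (e / z) q m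
        / (qPoch (a * e) q m * qPoch (b * e) q m * qPoch (e * f) q m)) := by
  have h1 := hae.qPochInf_ne_zero hq1
  have h2 := hbe.qPochInf_ne_zero hq1
  have h3 := hef.qPochInf_ne_zero hq1
  have h4 := (hez.mul_pow m).qPochInf_ne_zero hq1
  have h5 := (hez'.mul_pow m).qPochInf_ne_zero hq1
  rw [qPochInf_eq_mul hq1 _ m] at h1 h2 h3
  simp only [expansionRatio, qPochsInf, List.map_cons, List.map_nil, List.prod_cons,
    List.prod_nil]
  rw [← mul_assoc a, ← mul_assoc b, mul_right_comm e _ f, mul_right_comm e _ z,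
    mul_div_right_comm e, qPochInf_eq_mul hq1 (a * e) m, qPochInf_eq_mul hq1 (b * e) m,
    qPochInf_eq_mul hq1 (e * f) m, qPochInf_eq_mul hq1 (e * z) m, qPochInf_eq_mul hq1 (e / z) m]
  obtain ⟨h1, h1'⟩ := mul_ne_zero_iff.1 h1
  obtain ⟨h2, h2'⟩ := mul_ne_zero_iff.1 h2
  obtain ⟨h3, h3'⟩ := mul_ne_zero_iff.1 h3
  generalize qPochInf (b * e * q ^ m) q = B at *
  generalize qPochInf (e * f * q ^ m) q = F at *
  generalize qPochInf (e * z * q ^ m) q = Z at *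
  generalize qPochInf (e / z * q ^ m) q = Z' at *
  generalize qPoch (b * e) q m = B₀ at *
  field_simp

theorem sum_qNewtonTerm_node (hq0 : q ≠ 0) (hq1 : ‖q‖ < 1) {z a b e f : ℂ}
    (hz : z ≠ 0) (he : e ≠ 0) (hae : QRegular (a * e) q) (hbe : QRegular (b * e) q)
    (hef : QRegular (e * f) q) (hs : QRegular (a * b * e * f / q) q) (m : ℕ) :
    ∑ k ∈ range (m + 1), qNewtonTerm e (a * b * f) q k (e * q ^ m)
        * (expansionWeight a b e f q k * askeyWilson k ((z + z⁻¹) / 2) e a b f q)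
      = qPochInf (a * b * e * f) q * (qPoch (e * z) q m * qPoch (e / z) q m
        / (qPoch (a * e) q m * qPoch (b * e) q m * qPoch (e * f) q m)) := by
  rw [qPochInf_eq_mul hq1 (a * b * e * f) m,
    mul_right_comm (qPoch _ _ _),
    ← sum_expansionWeight_mul_askeyWilson hq0 (.of_norm_lt_one hq1 hq1) hz he hae hbe hef hs,
    sum_mul]
  refine sum_congr rfl fun k _ => ?_
  have hm := pow_ne_zero m hq0
  have hsm := ((hs.of_div hq0).mul_pow m).qPoch_ne_zero k
  rw [qNewtonTerm, prod_sub_mul_pow_eq (mul_ne_zero he hm),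
    show e / (e * q ^ m) = q ^ (-(m : ℤ)) by rw [zpow_neg, zpow_natCast]; field_simp,
    show a * b * f * (e * q ^ m) = a * b * e * f * q ^ m by ring,
    qPochInf_eq_mul hq1 (a * b * e * f * q ^ m) k]
  generalize qPoch (a * b * e * f * q ^ m) q k = B at *
  field_simp

theorem hasSum_qNewtonTerm_mul_askeyWilson (hq0 : q ≠ 0) (hq1 : ‖q‖ < 1) {z a b c e f : ℂ}
    (hz : z ≠ 0) (hb : b ≠ 0) (he : e ≠ 0) (hf : f ≠ 0) (hcz : ‖c * z‖ < 1)
    (hcz' : ‖c / z‖ < 1) (hae : QRegular (a * e) q) (hbe : QRegular (b * e) q)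
    (hef : QRegular (e * f) q) (hs : QRegular (a * b * e * f / q) q) (hez : QRegular (e * z) q)
    (hez' : QRegular (e / z) q) :
    HasSum (fun k => qNewtonTerm e (a * b * f) q k c
        * (expansionWeight a b e f q k * askeyWilson k ((z + z⁻¹) / 2) e a b f q))
      (expansionRatio a b e f z q c) := by
  obtain ⟨C₁, hC₁⟩ := exists_norm_expansionWeight_le hq1 hae hbe hef hs
  obtain ⟨C₂, hC₂⟩ := exists_norm_askeyWilson_le hq0 hq1 (b := a) hz he hb hf
  refine hasSum_qNewtonTerm_mul hq0 hq1 he (a * b * f) (C := C₁ * C₂)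
    (lt_max_of_lt_left (norm_pos_iff.2 hz)) (fun k => ?_)
    (differentiableOn_expansionRatio hq1 hz hae hbe hef) (fun m => ?_)
    ((norm_lt_inv_max_iff hz).2 ⟨hcz, hcz'⟩)
  · rw [norm_mul, mul_assoc C₁]
    exact mul_le_mul (hC₁ k) (hC₂ k) (norm_nonneg _) ((norm_nonneg _).trans (hC₁ k))
  · rw [sum_qNewtonTerm_node hq0 hq1 hz he hae hbe hef hs,
      expansionRatio_node hq1 hae hbe hef hez hez']

/-- The infinite product in front of both connection formulas. -/
noncomputable def expansionPrefactor (a b c e f z q : ℂ) : ℂ :=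
  qPochsInf [a * e, b * e, e * f, a * b * c * f, c * z, c / z] q
    / qPochsInf [a * c, b * c, c * f, a * b * e * f, e * z, e / z] q

theorem hasSum_expansionWeight_mul_askeyWilson (hq0 : q ≠ 0) (hq1 : ‖q‖ < 1) {z a b c e f : ℂ}
    (hz : z ≠ 0) (hb : b ≠ 0) (hc : c ≠ 0) (he : e ≠ 0) (hf : f ≠ 0) (hcz : ‖c * z‖ < 1)
    (hcz' : ‖c / z‖ < 1) (hae : QRegular (a * e) q) (hbe : QRegular (b * e) q)
    (hef : QRegular (e * f) q) (hs : QRegular (a * b * e * f / q) q) (hez : QRegular (e * z) q)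
    (hez' : QRegular (e / z) q) (habcf : QRegular (a * b * c * f) q) :
    HasSum (fun k => c ^ k * qPoch (e / c) q k / qPoch (a * b * c * f) q k
        * (expansionWeight a b e f q k * askeyWilson k ((z + z⁻¹) / 2) e a b f q))
      (expansionPrefactor a b c e f z q)⁻¹ := by
  have hinf := habcf.qPochInf_ne_zero hq1
  have hterm (k : ℕ) : qNewtonTerm e (a * b * f) q k c / qPochInf (a * b * c * f) q
      = c ^ k * qPoch (e / c) q k / qPoch (a * b * c * f) q k := by
    have h := hinf
    rw [qPochInf_eq_mul hq1 _ k] at h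
    rw [qNewtonTerm, prod_sub_mul_pow_eq hc, mul_right_comm (a * b) f c,
      qPochInf_eq_mul hq1 (a * b * c * f) k, mul_div_mul_right _ _ (right_ne_zero_of_mul h)]
  have hvalue : (expansionPrefactor a b c e f z q)⁻¹
      = expansionRatio a b e f z q c / qPochInf (a * b * c * f) q := by
    simp only [expansionPrefactor, expansionRatio, qPochsInf, List.map_cons, List.map_nil,
      List.prod_cons, List.prod_nil, inv_div, div_div]
    congr 1
    ring
  rw [hvalue]
  refine ((hasSum_qNewtonTerm_mul_askeyWilson hq0 hq1 hz hb he hf hcz hcz' hae hbe hef hs hez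
    hez').div_const _).congr_fun fun k => ?_
  rw [← hterm, mul_div_right_comm]

/-! ### The connection coefficients -/

section ConnectionCoefficient

theorem pow_mul_qPoch_div_pow (hq0 : q ≠ 0) {w : ℂ} (hw : w ≠ 0) (j k : ℕ) :
    (q ^ j) ^ k * qPoch (w / q ^ j) q k * qPoch (q ^ (1 - (k : ℤ)) / w) q j
      = qPoch w q k * qPoch (q / w) q j := by
  have hj := pow_ne_zero j hq0
  have hwj := div_ne_zero hw hj
  have hcross := (qPoch_add (w / q ^ j) q j k).symm.trans
    ((congrArg _ (add_comm j k)).trans (qPoch_add (w / q ^ j) q k j))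
  have hleft : q ^ (1 - (j : ℤ)) / (w / q ^ j) = q / w := by
    rw [zpow_sub₀ hq0, zpow_one, zpow_natCast]
    field_simp
  have hright : q ^ (1 - (j : ℤ)) / (w / q ^ j * q ^ k) = q ^ (1 - (k : ℤ)) / w := by
    rw [zpow_sub₀ hq0, zpow_sub₀ hq0, zpow_one, zpow_natCast, zpow_natCast]
    field_simp
  rw [div_mul_cancel₀ w hj, qPoch_reflect hq0 hwj, hleft,
    qPoch_reflect hq0 (mul_ne_zero hwj (pow_ne_zero k hq0)), hright, ← neg_mul, mul_pow _ (q ^ k),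
    pow_right_comm q k j] at hcross
  have hunit : (-(w / q ^ j)) ^ j * q ^ j.choose 2 ≠ 0 :=
    mul_ne_zero (pow_ne_zero j (neg_ne_zero.2 hwj)) (pow_ne_zero _ hq0)
  refine mul_left_cancel₀ hunit ?_
  linear_combination -hcross

theorem mul_pow_mul_qPoch_div_qPoch_add (hq0 : q ≠ 0) {t : ℂ} (ht : t ≠ 0) (X F : ℂ) (i n : ℕ)
    (hi : qPoch (q ^ (1 - (n : ℤ)) / t) q i ≠ 0) :
    (X * q ^ i) ^ n * qPoch (t / q ^ i) q n / qPoch F q (i + n)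
      = X ^ n * qPoch t q n / qPoch F q n
        * (qPoch (q / t) q i / (qPoch (q ^ n * F) q i * qPoch (q ^ (1 - (n : ℤ)) / t) q i)) := by
  rw [add_comm i n, qPoch_add, mul_comm F, div_mul_div_comm, mul_assoc (X ^ n),
    ← pow_mul_qPoch_div_pow hq0 ht, ← mul_assoc (qPoch F q n), ← mul_assoc (X ^ n),
    mul_div_mul_right _ _ hi, mul_pow]
  ring

theorem sum_awWeight_eq_basicHyp (hq0 : q ≠ 0) (n : ℕ) (s C D F G : ℂ) {E : ℂ}
    (hE : ∀ j < n, E * q ^ j ≠ 1) :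
    ∑ j ∈ range (n + 1), awWeight s q n j * (qPoch (E * q ^ j) q (n - j)
        * (qPoch C q j * (qPoch D q j / (qPoch F q j * qPoch G q j))))
      = qPoch E q n
        * basicHyp [q ^ (-(n : ℤ)), q ^ ((n : ℤ) - 1) * s, C, D] [E, F, G] q q := by
  rw [basicHyp, tsum_eq_sum (s := range (n + 1)) fun k hk => ?_, mul_sum]
  · refine sum_congr rfl fun j hj => ?_
    have hjn := Nat.lt_succ_iff.1 (mem_range.1 hj)
    have hEj := qPoch_ne_zero hE hjn
    rw [qPoch_split E q hjn, awWeight]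
    simp only [qPochs, List.map_cons, List.map_nil, List.prod_cons, List.prod_nil,
      List.length_cons, List.length_nil]
    generalize qPoch E q j = V at hEj
    field_simp
    norm_num
  · simp only [qPochs, List.map_cons, List.prod_cons,
      qPoch_neg_pow_eq_zero hq0 (by simpa [Nat.lt_succ_iff] using hk), zero_mul, zero_div]

theorem sum_awWeight_balanced_shift (hq0 : q ≠ 0) (hq : QRegular q q) {s X E F : ℂ} (hX : X ≠ 0)
    (hE : E ≠ 0) (hF : QRegular F q) (h : X * s = E * F) (i N : ℕ) :
    ∑ m ∈ range (N + 1), awWeight s q N m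
        * (qPoch (E * q ^ m) q (N - m) * (qPoch X q (i + m) / qPoch F q (i + m)))
      = qPoch X q i * qPoch (F / X) q N
        * ((X * q ^ i) ^ N * qPoch (E / X / q ^ i) q N / qPoch F q (i + N)) := by
  have hi := pow_ne_zero i hq0
  have hsum := sum_awWeight_balanced_div hq0 hq (mul_ne_zero hX hi) hE (hF.mul_pow i)
    (by linear_combination q ^ i * h : X * q ^ i * s = E * (F * q ^ i)) N
  rw [mul_div_mul_right _ _ hi, ← div_div] at hsum
  calc _ = qPoch X q i / qPoch F q i * ∑ m ∈ range (N + 1), awWeight s q N m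
        * (qPoch (E * q ^ m) q (N - m) * (qPoch (X * q ^ i) q m / qPoch (F * q ^ i) q m)) := by
        rw [mul_sum]
        refine sum_congr rfl fun m _ => ?_
        rw [qPoch_add, qPoch_add, ← div_mul_div_comm]
        ring
    _ = _ := by
        rw [hsum, qPoch_add F, ← div_div]
        ring

/-- The coefficient, up to the factor `c⁻ⁿ` and `expansionWeight`, of `p_k(x; a, b, e, f | q)` in
the expansion of `p_n(x; a, b, c, d | q)`, as it comes out of expanding each `(cz, c/z; q)_j` in
the latter. -/
noncomputable def connectionCoeff (a b c d e f q : ℂ) (n k : ℕ) : ℂ :=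
  ∑ j ∈ range (n + 1), awWeight (a * b * c * d) q n j * (qPoch (c * d * q ^ j) q (n - j)
    * (qPoch (c * f) q j
      * ((c * q ^ j) ^ k * qPoch (e / c / q ^ j) q k / qPoch (a * b * c * f) q (j + k))))

variable {a b c d e f : ℂ}

theorem connectionCoeff_eq_mul_basicHyp (hq0 : q ≠ 0) (hc : c ≠ 0) (he : e ≠ 0) (a b f : ℂ)
    (n k : ℕ) (hcd : ∀ j < n, c * d * q ^ j ≠ 1)
    (hce : ∀ j < n, q ^ (1 - (k : ℤ)) * (c / e) * q ^ j ≠ 1) :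
    connectionCoeff a b c d e f q n k
      = qPoch (c * d) q n * (c ^ k * qPoch (e / c) q k / qPoch (a * b * c * f) q k)
        * basicHyp [q ^ (-(n : ℤ)), q ^ ((n : ℤ) - 1) * (a * b * c * d), c * f, q * c / e]
            [c * d, q ^ k * (a * b * c * f), q ^ (1 - (k : ℤ)) * (c / e)] q q := by
  rw [connectionCoeff, mul_right_comm (qPoch (c * d) q n),
    ← sum_awWeight_eq_basicHyp hq0 n _ _ _ _ _ hcd, sum_mul]
  refine sum_congr rfl fun j hj => ?_
  have hbase : q ^ (1 - (k : ℤ)) / (e / c) = q ^ (1 - (k : ℤ)) * (c / e) := by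
    rw [div_div_eq_mul_div, mul_div_assoc]
  have hne := qPoch_ne_zero hce (Nat.lt_succ_iff.1 (mem_range.1 hj))
  rw [mul_pow_mul_qPoch_div_qPoch_add hq0 (div_ne_zero he hc) c (a * b * c * f) j k
    (by rwa [hbase]), hbase, div_div_eq_mul_div q]
  ring

theorem mul_connectionCoeff_eq_sum_sum (hq0 : q ≠ 0) (hq : QRegular q q) (hc : c ≠ 0)
    (he : e ≠ 0) (hf : f ≠ 0) (habcf : QRegular (a * b * c * f) q) (d : ℂ) (n k : ℕ) :
    f ^ k * qPoch (a * b) q k * connectionCoeff a b c d e f q n k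
      = ∑ i ∈ range (k + 1), awWeight (a * b * e * f) q k i * (qPoch (e * f * q ^ i) q (k - i)
        * ∑ j ∈ range (n + 1), awWeight (a * b * c * d) q n j * (qPoch (c * d * q ^ j) q (n - j)
          * (qPoch (c * f) q (i + j) / qPoch (a * b * c * f) q (i + j)))) := by
  have hexpand (j : ℕ) := sum_awWeight_balanced_shift hq0 hq (s := a * b * e * f)
    (mul_ne_zero hc hf) (mul_ne_zero he hf) habcf (by ring) j k
  simp only [mul_div_mul_right e c hf, mul_assoc (a * b) c f,
    mul_div_cancel_right₀ (a * b) (mul_ne_zero hc hf)] at hexpand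
  calc _ = ∑ j ∈ range (n + 1), awWeight (a * b * c * d) q n j
        * (qPoch (c * d * q ^ j) q (n - j) * ∑ i ∈ range (k + 1), awWeight (a * b * e * f) q k i
          * (qPoch (e * f * q ^ i) q (k - i)
            * (qPoch (c * f) q (j + i) / qPoch (a * b * (c * f)) q (j + i)))) := by
        rw [connectionCoeff, mul_sum]
        refine sum_congr rfl fun j _ => ?_
        rw [hexpand, mul_assoc (a * b) c f, mul_right_comm c f, mul_pow _ f]
        ring
    _ = _ := by
        simp only [mul_sum]
        rw [sum_comm]
        refine sum_congr rfl fun i _ => sum_congr rfl fun j _ => ?_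
        rw [add_comm j i, mul_assoc (a * b) c f]
        ring

theorem mul_connectionCoeff_eq_mul_basicHyp (hq0 : q ≠ 0) (hq : QRegular q q) (hc : c ≠ 0)
    (hd : d ≠ 0) (he : e ≠ 0) (hf : f ≠ 0) (habcf : QRegular (a * b * c * f) q)
    (hef : QRegular (e * f) q) (n k : ℕ) (hfd : QRegular (q ^ (1 - (n : ℤ)) * (f / d)) q) :
    f ^ k * qPoch (a * b) q k * connectionCoeff a b c d e f q n k
      = qPoch (e * f) q k
        * (qPoch (a * b) q n * ((c * f) ^ n * qPoch (d / f) q n / qPoch (a * b * c * f) q n))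
        * basicHyp [q ^ (-(k : ℤ)), q ^ ((k : ℤ) - 1) * (a * b * e * f), c * f, q * f / d]
            [e * f, q ^ n * (a * b * c * f), q ^ (1 - (n : ℤ)) * (f / d)] q q := by
  rw [mul_connectionCoeff_eq_sum_sum hq0 hq hc he hf habcf,
    mul_right_comm (qPoch (e * f) q k),
    ← sum_awWeight_eq_basicHyp hq0 k _ _ _ _ _ fun j _ => hef j, sum_mul]
  refine sum_congr rfl fun i _ => ?_
  have hbase : q ^ (1 - (n : ℤ)) / (d / f) = q ^ (1 - (n : ℤ)) * (f / d) := by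
    rw [div_div_eq_mul_div, mul_div_assoc]
  have hratio : a * b * c * f / (c * f) = a * b := by
    rw [mul_assoc (a * b), mul_div_cancel_right₀ _ (mul_ne_zero hc hf)]
  rw [sum_awWeight_balanced_shift hq0 hq (mul_ne_zero hc hf) (mul_ne_zero hc hd) habcf (by ring),
    hratio, mul_div_mul_left d f hc, mul_pow_mul_qPoch_div_qPoch_add hq0 (div_ne_zero hd hf) _ _ i n
    (by rw [hbase]; exact hfd.qPoch_ne_zero i), hbase, div_div_eq_mul_div q]
  ring

end ConnectionCoefficient

section Connection

theorem qPochsInf_ne_zero (hq1 : ‖q‖ < 1) {as : List ℂ} (h : ∀ w ∈ as, QRegular w q) :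
    qPochsInf as q ≠ 0 := by
  rw [qPochsInf, ne_eq, List.prod_eq_zero_iff, List.mem_map]
  rintro ⟨w, hw, hzero⟩
  exact (h w hw).qPochInf_ne_zero hq1 hzero

theorem expansionPrefactor_eq_mul (hq1 : ‖q‖ < 1) (a b c e f z : ℂ) (j : ℕ) :
    expansionPrefactor a b c e f z q = expansionPrefactor a b (c * q ^ j) e f z q
      * (qPoch (a * b * c * f) q j * qPoch (c * z) q j * qPoch (c / z) q j
        / (qPoch (a * c) q j * qPoch (b * c) q j * qPoch (c * f) q j)) := by
  simp only [expansionPrefactor, qPochsInf, List.map_cons, List.map_nil, List.prod_cons,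
    List.prod_nil, mul_one, ← mul_assoc, mul_right_comm _ (q ^ j), mul_div_right_comm c (q ^ j) z]
  rw [qPochInf_eq_mul hq1 (a * c) j, qPochInf_eq_mul hq1 (b * c) j,
    qPochInf_eq_mul hq1 (c * f) j, qPochInf_eq_mul hq1 (a * b * c * f) j,
    qPochInf_eq_mul hq1 (c * z) j, qPochInf_eq_mul hq1 (c / z) j]
  simp only [div_eq_mul_inv, mul_inv]
  ring

variable {z a b c d e f : ℂ}

theorem inv_expansionPrefactor_mul (hq1 : ‖q‖ < 1) (hcz : ‖c * z‖ < 1) (hcz' : ‖c / z‖ < 1)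
    (hac : QRegular (a * c) q) (hbc : QRegular (b * c) q) (hcf : QRegular (c * f) q)
    (habcf : QRegular (a * b * c * f) q) (e : ℂ) (j : ℕ) :
    (expansionPrefactor a b (c * q ^ j) e f z q)⁻¹
        * (qPoch (c * f) q j / qPoch (a * b * c * f) q j)
      = (expansionPrefactor a b c e f z q)⁻¹
        * (qPoch (c * z) q j * qPoch (c / z) q j / (qPoch (a * c) q j * qPoch (b * c) q j)) := by
  have h1 := (QRegular.of_norm_lt_one hq1 hcz).qPoch_ne_zero j
  have h2 := (QRegular.of_norm_lt_one hq1 hcz').qPoch_ne_zero j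
  have h3 := hac.qPoch_ne_zero j
  have h4 := hbc.qPoch_ne_zero j
  have h5 := hcf.qPoch_ne_zero j
  have h6 := habcf.qPoch_ne_zero j
  rw [expansionPrefactor_eq_mul hq1 a b c e f z j]
  generalize qPoch (c * z) q j = Z, qPoch (c / z) q j = W at *
  generalize qPoch (a * b * c * f) q j = U, qPoch (a * c) q j = A, qPoch (b * c) q j = B at *
  field_simp

theorem expansionPrefactor_ne_zero (hq0 : q ≠ 0) (hq1 : ‖q‖ < 1) (hcz : ‖c * z‖ < 1)
    (hcz' : ‖c / z‖ < 1) (hac : QRegular (a * c) q) (hbc : QRegular (b * c) q)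
    (hcf : QRegular (c * f) q) (hae : QRegular (a * e) q) (hbe : QRegular (b * e) q)
    (hef : QRegular (e * f) q) (habcf : QRegular (a * b * c * f) q)
    (hs : QRegular (a * b * e * f / q) q) (hez : QRegular (e * z) q)
    (hez' : QRegular (e / z) q) : expansionPrefactor a b c e f z q ≠ 0 := by
  refine div_ne_zero (qPochsInf_ne_zero hq1 ?_) (qPochsInf_ne_zero hq1 ?_)
  · simpa only [List.forall_mem_cons, List.not_mem_nil, false_imp_iff, implies_true, and_true]
      using ⟨hae, hbe, hef, habcf, .of_norm_lt_one hq1 hcz, .of_norm_lt_one hq1 hcz'⟩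
  · simpa only [List.forall_mem_cons, List.not_mem_nil, false_imp_iff, implies_true, and_true]
      using ⟨hac, hbc, hcf, hs.of_div hq0, hez, hez'⟩

theorem sum_awWeight_mul_inv_expansionPrefactor (hq1 : ‖q‖ < 1) (hz : z ≠ 0)
    (hc : c ≠ 0) (hcz : ‖c * z‖ < 1) (hcz' : ‖c / z‖ < 1) (hac : QRegular (a * c) q)
    (hbc : QRegular (b * c) q) (hcf : QRegular (c * f) q) (habcf : QRegular (a * b * c * f) q)
    (d e : ℂ) (n : ℕ) :
    ∑ j ∈ range (n + 1), awWeight (a * b * c * d) q n j * (qPoch (c * d * q ^ j) q (n - j)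
        * ((expansionPrefactor a b (c * q ^ j) e f z q)⁻¹
          * (qPoch (c * f) q j / qPoch (a * b * c * f) q j)))
      = c ^ n * askeyWilson n ((z + z⁻¹) / 2) c a b d q
        / (expansionPrefactor a b c e f z q * (qPoch (a * c) q n * qPoch (b * c) q n)) := by
  rw [askeyWilson_eq_sum_awWeight n hz, mul_inv_cancel_left₀ (pow_ne_zero n hc), sum_div]
  refine sum_congr rfl fun j hj => ?_
  have hjn := Nat.lt_succ_iff.1 (mem_range.1 hj)
  have h1 := hac.qPoch_ne_zero n
  have h2 := hbc.qPoch_ne_zero n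
  rw [qPoch_split _ _ hjn, mul_ne_zero_iff] at h1 h2
  rw [inv_expansionPrefactor_mul hq1 hcz hcz' hac hbc hcf habcf, mul_comm c a, mul_comm c b,
    show a * c * b * d = a * b * c * d by ring, qPoch_split (a * c) q hjn,
    qPoch_split (b * c) q hjn]
  obtain ⟨h1, h1'⟩ := h1
  obtain ⟨h2, h2'⟩ := h2
  field_simp

theorem hasSum_connectionCoeff (hq0 : q ≠ 0) (hq1 : ‖q‖ < 1) (n : ℕ) (hz : z ≠ 0) (ha : a ≠ 0)
    (hb : b ≠ 0) (hc : c ≠ 0) (hd : d ≠ 0) (he : e ≠ 0) (hf : f ≠ 0) (hcz : ‖c * z‖ < 1)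
    (hcz' : ‖c / z‖ < 1) (hac : QRegular (a * c) q) (hbc : QRegular (b * c) q)
    (hcf : QRegular (c * f) q) (hae : QRegular (a * e) q) (hbe : QRegular (b * e) q)
    (hef : QRegular (e * f) q) (habcf : QRegular (a * b * c * f) q)
    (hs : QRegular (a * b * e * f / q) q) (hez : QRegular (e * z) q)
    (hez' : QRegular (e / z) q) :
    HasSum (fun k => (c ^ n)⁻¹ * (expansionWeight a b e f q k
        * askeyWilson k ((z + z⁻¹) / 2) a b e f q * connectionCoeff a b c d e f q n k))
      (askeyWilson n ((z + z⁻¹) / 2) a b c d q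
        / (expansionPrefactor a b c e f z q * (qPoch (a * c) q n * qPoch (b * c) q n))) := by
  have hq := QRegular.of_norm_lt_one hq1 hq1
  have hnode (j : ℕ) := hasSum_expansionWeight_mul_askeyWilson (c := c * q ^ j) hq0 hq1 hz hb
    (mul_ne_zero hc (pow_ne_zero j hq0)) he hf
    (by rw [mul_right_comm]; exact (norm_mul_pow_le hq1 _ j).trans_lt hcz)
    (by rw [mul_div_right_comm]; exact (norm_mul_pow_le hq1 _ j).trans_lt hcz')
    hae hbe hef hs hez hez'
    (by simpa only [← mul_assoc, mul_right_comm _ (q ^ j) f] using habcf.mul_pow j)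
  have hsum := (hasSum_sum (s := range (n + 1)) fun j _ => (hnode j).mul_left
    (awWeight (a * b * c * d) q n j * (qPoch (c * d * q ^ j) q (n - j)
      * (qPoch (c * f) q j / qPoch (a * b * c * f) q j)))).mul_left (c ^ n)⁻¹
  have hvalue := sum_awWeight_mul_inv_expansionPrefactor hq1 hz hc hcz hcz' hac hbc hcf habcf d e n
  rw [← askeyWilson_rotate hq0 hq n hz ha hb hc hd, mul_div_assoc] at hvalue
  convert! hsum using 1
  · funext k
    rw [connectionCoeff, askeyWilson_rotate hq0 hq k hz ha hb he hf, mul_sum]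
    congr 1
    refine sum_congr rfl fun j _ => ?_
    rw [qPoch_add, show a * b * (c * q ^ j) * f = a * b * c * f * q ^ j by ring, div_div e c]
    simp only [div_eq_mul_inv, mul_inv]
    ring
  · rw [← inv_mul_cancel_left₀ (pow_ne_zero n hc) (_ / _), ← hvalue]
    congr 1
    refine sum_congr rfl fun j _ => ?_
    ring

end Connection

section Summands

variable {a b c d e f : ℂ}

theorem qPoch_div_ne_zero_of_reflect (hq0 : q ≠ 0) (hd : d ≠ 0) (hf : f ≠ 0) {n : ℕ}
    (hfd : QRegular (q ^ (1 - (n : ℤ)) * (f / d)) q) : qPoch (d / f) q n ≠ 0 := by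
  have hdf := div_ne_zero hd hf
  rw [qPoch_reflect hq0 hdf, div_div_eq_mul_div, mul_div_assoc]
  exact mul_ne_zero (mul_ne_zero (pow_ne_zero n (neg_ne_zero.2 hdf)) (pow_ne_zero _ hq0))
    (hfd.qPoch_ne_zero n)

theorem first_summand_eq_connectionCoeff (hq0 : q ≠ 0) (hc : c ≠ 0) (he : e ≠ 0) (a b f p : ℂ)
    (n k : ℕ) (hcd : ∀ j < n, c * d * q ^ j ≠ 1)
    (hce : ∀ j < n, q ^ (1 - (k : ℤ)) * (c / e) * q ^ j ≠ 1) :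
    c ^ ((k : ℤ) - n)
        * (qPoch (a * b * e * f) q (2 * k) * qPochs [e / c, a * b * e * f / q] q k
          / (qPoch (a * b * e * f / q) q (2 * k)
            * qPochs [q, a * e, b * e, e * f, a * b * c * f] q k))
        * p
        * basicHyp [q ^ (-(n : ℤ)), q ^ ((n : ℤ) - 1) * (a * b * c * d), c * f, q * c / e]
            [c * d, q ^ k * (a * b * c * f), q ^ (1 - (k : ℤ)) * (c / e)] q q
      = (c ^ n)⁻¹ * (expansionWeight a b e f q k * p * connectionCoeff a b c d e f q n k)
        / qPoch (c * d) q n := by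
  have hcdn := qPoch_ne_zero hcd le_rfl
  rw [connectionCoeff_eq_mul_basicHyp hq0 hc he a b f n k hcd hce, eq_div_iff hcdn, zpow_sub₀ hc,
    zpow_natCast, zpow_natCast, expansionWeight, veryWellPoised]
  simp only [qPochs, List.map_cons, List.map_nil, List.prod_cons, List.prod_nil, mul_one,
    div_eq_mul_inv, mul_inv]
  ring

theorem second_summand_eq_connectionCoeff (hq0 : q ≠ 0) (hq : QRegular q q) (hc : c ≠ 0)
    (hd : d ≠ 0) (he : e ≠ 0) (hf : f ≠ 0) (hab : QRegular (a * b) q)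
    (hef : QRegular (e * f) q) (habcf : QRegular (a * b * c * f) q) (p : ℂ) (n k : ℕ)
    (hfd : QRegular (q ^ (1 - (n : ℤ)) * (f / d)) q) :
    f ^ ((n : ℤ) - k)
        * (qPoch (a * b * e * f) q (2 * k) * qPoch (a * b * e * f / q) q k
          / (qPoch (a * b * e * f / q) q (2 * k) * qPochs [q, a * b, a * e, b * e] q k))
        * p
        * basicHyp [q ^ (-(k : ℤ)), q ^ ((k : ℤ) - 1) * (a * b * e * f), c * f, q * f / d]
            [e * f, q ^ n * (a * b * c * f), q ^ (1 - (n : ℤ)) * (f / d)] q q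
      = (c ^ n)⁻¹ * (expansionWeight a b e f q k * p * connectionCoeff a b c d e f q n k)
        / (qPoch (a * b) q n * qPoch (d / f) q n / qPoch (a * b * c * f) q n) := by
  set κ := qPoch (a * b) q n * qPoch (d / f) q n / qPoch (a * b * c * f) q n with hκ_def
  have hκ : κ ≠ 0 :=
    div_ne_zero (mul_ne_zero (hab.qPoch_ne_zero n) (qPoch_div_ne_zero_of_reflect hq0 hd hf hfd))
      (habcf.qPoch_ne_zero n)
  have hefk := hef.qPoch_ne_zero k
  have habk := hab.qPoch_ne_zero k
  have hcoeff := mul_connectionCoeff_eq_mul_basicHyp hq0 hq hc hd he hf habcf hef n k hfd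
  generalize basicHyp _ _ _ _ = Φ at *
  have hsolved : connectionCoeff a b c d e f q n k
      = qPoch (e * f) q k * κ * (c ^ n * f ^ n) * Φ / (f ^ k * qPoch (a * b) q k) := by
    rw [eq_div_iff (mul_ne_zero (pow_ne_zero k hf) habk), mul_comm, hcoeff, hκ_def]
    ring
  rw [hsolved, expansionWeight, veryWellPoised, zpow_sub₀ hf, zpow_natCast, zpow_natCast]
  simp only [qPochs, List.map_cons, List.map_nil, List.prod_cons, List.prod_nil, mul_one]
  clear_value κ
  generalize qPoch (e * f) q k = V, qPoch (a * b) q k = U at *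
  field_simp

end Summands

theorem theorem6p1 (n : ℕ) (q z a b c d e f : ℂ)
    (hq0 : q ≠ 0) (hq1 : ‖q‖ < 1)
    (hz : z ≠ 0) (ha : a ≠ 0) (hb : b ≠ 0) (hc : c ≠ 0) (hd : d ≠ 0) (he : e ≠ 0) (hf : f ≠ 0)
    (hcz : max ‖c * z‖ ‖c / z‖ < 1)
    -- the denominators common to both expansions do not vanish
    (hden : ∀ w ∈ [a * c, b * c, c * f, a * e, b * e, e * f, a * b * c * f, a * b * e * f / q,
      e * z, e / z], ∀ j : ℕ, w * q ^ j ≠ 1) :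
    -- first expansion, whenever the remaining denominators of its `_4φ_3` do not vanish
    ((∀ j < n, c * d * q ^ j ≠ 1) →
      (∀ k : ℕ, ∀ j < n, q ^ (1 - (k : ℤ)) * (c / e) * q ^ j ≠ 1) →
      ∃ S : ℂ,
        HasSum (fun k : ℕ => c ^ ((k : ℤ) - n)
          * (qPoch (a * b * e * f) q (2 * k) * qPochs [e / c, a * b * e * f / q] q k
            / (qPoch (a * b * e * f / q) q (2 * k)
              * qPochs [q, a * e, b * e, e * f, a * b * c * f] q k))
          * askeyWilson k ((z + z⁻¹) / 2) a b e f q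
          * basicHyp [q ^ (-(n : ℤ)), q ^ ((n : ℤ) - 1) * (a * b * c * d), c * f, q * c / e]
              [c * d, q ^ k * (a * b * c * f), q ^ (1 - (k : ℤ)) * (c / e)] q q) S ∧
        askeyWilson n ((z + z⁻¹) / 2) a b c d q =
          qPochsInf [a * e, b * e, e * f, a * b * c * f, c * z, c / z] q
            / qPochsInf [a * c, b * c, c * f, a * b * e * f, e * z, e / z] q
          * qPochs [a * c, b * c, c * d] q n * S) ∧
    -- second expansion, whenever its remaining denominators do not vanish
    ((∀ j : ℕ, a * b * q ^ j ≠ 1) →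
      (∀ j : ℕ, q ^ (1 - (n : ℤ)) * (f / d) * q ^ j ≠ 1) →
      ∃ S : ℂ,
        HasSum (fun k : ℕ => f ^ ((n : ℤ) - k)
          * (qPoch (a * b * e * f) q (2 * k) * qPoch (a * b * e * f / q) q k
            / (qPoch (a * b * e * f / q) q (2 * k) * qPochs [q, a * b, a * e, b * e] q k))
          * askeyWilson k ((z + z⁻¹) / 2) a b e f q
          * basicHyp [q ^ (-(k : ℤ)), q ^ ((k : ℤ) - 1) * (a * b * e * f), c * f, q * f / d]
              [e * f, q ^ n * (a * b * c * f), q ^ (1 - (n : ℤ)) * (f / d)] q q) S ∧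
        askeyWilson n ((z + z⁻¹) / 2) a b c d q =
          qPochsInf [a * e, b * e, e * f, a * b * c * f, c * z, c / z] q
            / qPochsInf [a * c, b * c, c * f, a * b * e * f, e * z, e / z] q
          * (qPochs [a * b, a * c, b * c, d / f] q n / qPoch (a * b * c * f) q n) * S) := by
  simp only [List.forall_mem_cons, List.not_mem_nil, false_imp_iff, implies_true, and_true] at hden
  obtain ⟨hac, hbc, hcf, hae, hbe, hef, habcf, hs, hez, hez'⟩ := hden
  obtain ⟨hcz, hcz'⟩ := max_lt_iff.1 hcz
  have hsum := hasSum_connectionCoeff hq0 hq1 n hz ha hb hc hd he hf hcz hcz' hac hbc hcf hae hbe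
    hef habcf hs hez hez'
  have hP := expansionPrefactor_ne_zero hq0 hq1 hcz hcz' hac hbc hcf hae hbe hef habcf hs hez hez'
  have hnorm := mul_ne_zero (QRegular.qPoch_ne_zero hac n) (QRegular.qPoch_ne_zero hbc n)
  have hvalue {κ : ℂ} (hκ : κ ≠ 0) (p : ℂ) : p = expansionPrefactor a b c e f z q
      * (qPoch (a * c) q n * qPoch (b * c) q n * κ) * (p / (expansionPrefactor a b c e f z q
        * (qPoch (a * c) q n * qPoch (b * c) q n)) / κ) := by
    rw [div_div, ← mul_assoc (expansionPrefactor a b c e f z q),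
      mul_div_cancel₀ _ (mul_ne_zero (mul_ne_zero hP hnorm) hκ)]
  refine ⟨fun hcd hce => ⟨_, (hsum.div_const (qPoch (c * d) q n)).congr_fun fun k =>
    first_summand_eq_connectionCoeff hq0 hc he a b f _ n k hcd (hce k), ?_⟩, fun hab hfd => ⟨_,
    (hsum.div_const (qPoch (a * b) q n * qPoch (d / f) q n / qPoch (a * b * c * f) q n)).congr_fun
      fun k => second_summand_eq_connectionCoeff hq0 (.of_norm_lt_one hq1 hq1) hc hd he hf hab hef
        habcf _ n k hfd, ?_⟩⟩
  · refine (hvalue (qPoch_ne_zero hcd le_rfl) _).trans ?_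
    simp only [expansionPrefactor, qPochs, List.map_cons, List.map_nil, List.prod_cons,
      List.prod_nil, mul_one]
    ring
  · refine (hvalue (div_ne_zero (mul_ne_zero (QRegular.qPoch_ne_zero hab n)
      (qPoch_div_ne_zero_of_reflect hq0 hd hf hfd)) (QRegular.qPoch_ne_zero habcf n)) _).trans ?_
    simp only [expansionPrefactor, qPochs, List.map_cons, List.map_nil, List.prod_cons,
      List.prod_nil, mul_one]
    ring
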